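/- \textbf{Setting.} Work on $\mathbb R^4$ with coordinates $x^\mu$, $\mu=0,\dots,3$, Minkowski metric $\eta=\mathrm{diag}(1,-1,-1,-1)$ and metrics $g_{\mu\nu}=\eta_{\mu\nu}+\varkappa h_{\mu\nu}$ with graviton field $h$. Repeated Lorentz indices are summed over $0,\dots,3$. Put $\Gamma_{\mu\nu}{}^{\tau}=\tfrac12 g^{\tau\sigma}(\partial_\mu g_{\sigma\nu}+\partial_\nu g_{\mu\sigma}-\partial_\sigma g_{\mu\nu})$ and $dV_g=\sqrt{-\det g}\,d^4x$. The vielbein $e_\mu^m$ of $g$ satisfies $g_{\mu\nu}=\eta_{mn}e_\mu^m e_\nu^n$ in the symmetric gauge, i.e. as a matrix $(e_\mu^m)$ is the principal square root of $\eta^{-1}g$; $e^\rho_r$ is its inverse and $e^{\rho r}=\eta^{rs}e^\rho_s$. For tensors ${}_kT$ (independent of $h$) the matter-model Lagrange densities ${}_k\mathcal L$ of type $k=1,\dots,10$ are the products of $dV_g$ with, respectively, $$\begin{gathered}{}_1T,\quad g^{\mu\nu}\,{}_2T_{\mu\nu},\quad g^{\mu\nu}g^{\rho\sigma}\,{}_3T_{\mu\nu\rho\sigma},\quad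 g^{\mu\nu}\Gamma_{\mu\nu}{}^\tau\,{}_4T_\tau,\quad g^{\mu\nu}g^{\rho\sigma}\Gamma_{\mu\nu}{}^\tau\,{}_5T_{\rho\sigma\tau},\quad g^{\mu\nu}g^{\rho\sigma}\Gamma_{\mu\nu}{}^\kappa\Gamma_{\rho\sigma}{}^\lambda\,{}_6T_{\kappa\lambda},\\ e_0^o\,{}_7T_o,\quad e_0^oe^{\rho r}\,{}_8T_{o\rho r},\quad e_0^oe^{\rho r}e^{\sigma s}(\partial_\rho e_\sigma^t)\,{}_9T_{orst},\quad e_0^oe^{\rho r}e^{\sigma s}e_\tau^t\Gamma_{\rho\sigma}{}^\tau\,{}_{10}T_{orst}.\end{gathered}$$ \textbf{Vertex rules.} The graviton-matter $n$-point vertex rule ${}_k\mathfrak M_n^{\mu_1\nu_1|\cdots|\mu_n\nu_n}(p_1,\dots,p_n)$, $n\ge0$, contracted with a tensor $T$, is $\mathrm i$ times the matrix element, at momentum equal to the total momentum, of the order-$\varkappa^n$ part of ${}_k\mathcal L$, extended to $n$ distinguishable gravitons by full polarization (the mixed derivative $\partial_{c_1}\cdots\partial_{c_n}$ at $c=0$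 of its value at $h=\sum_j c_jh_j$), where $h_j$ is the symmetrized Fourier mode $\tfrac12(\delta_\rho^{\mu_j}\delta_\sigma^{\nu_j}+\delta_\sigma^{\mu_j}\delta_\rho^{\nu_j})\exp(p_{j,\lambda}x^\lambda)$ and the matter tensor is a Fourier mode $T\exp(q_\lambda x^\lambda)$. Momenta are normalized so that $\partial_\mu$ acts on a mode as multiplication by $p_\mu=\eta_{\mu\sigma}p^\sigma$; the momenta may be any complex vectors, and plane waves $e^{\mathrm i k_\lambda x^\lambda}$ correspond to $p=\mathrm i k$. \textbf{Theorem.} For every type $k$, every $n$, all momenta and all Lorentz indices, $${}_k\mathfrak M_n^{\mu_1\nu_1|\cdots|\mu_n\nu_n}(p_1,\dots,p_n)=\frac{\mathrm i}{2^n}\sum_{\mu_i\leftrightarrow\nu_i}\ \sum_{s\in S_n}{}_k\mathfrak m_n^{\mu_{s(1)}\nu_{s(1)}|\cdots|\mu_{s(n)}\nu_{s(n)}}(p_{s(1)},\dots,p_{s(n)}),$$ where the first sum is over the $2^n$ ways of exchanging or not exchanging $\mu_i$ and $\nu_i$ for each $i$. The ${}_k\mathfrak m_n$ are the following, with the conventions: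 the $n$ gravitons $1,\dots,n$, in this order, are first used up by the factors $\boldsymbol\Gamma$ (the first one by $\boldsymbol\Gamma$ with argument $p_1$, the second one by $\boldsymbol\Gamma$ with argument $p_2$) and then by consecutive blocks of sizes $m_1,m_2,\dots$, which are attached, in this order, to the factors with subscripts $m_1,m_2,\dots$; all $m_j\ge0$; empty sums are $0$. $$\begin{aligned} {}_1\mathfrak m_n&=T\,\mathfrak v_n,\\ {}_2\mathfrak m_n&=T_{\mu\nu}\sum_{m_1+m_2=n}(-1)^{m_1}\mathfrak h^{\mu\nu}_{m_1}\mathfrak v_{m_2},\\ {}_3\mathfrak m_n&=T_{\mu\nu\rho\sigma}\sum_{m_1+m_2+m_3=n}(-1)^{m_1+m_2}\mathfrak h^{\mu\nu}_{m_1}\mathfrak h^{\rho\sigma}_{m_2}\mathfrak v_{m_3},\\ {}_4\mathfrak m_n&=T_\rho\,\boldsymbol\Gamma_{\mu\nu\sigma}(p_1)\sum_{m_1+m_2+m_3=n-1}(-1)^{m_1+m_2}\mathfrak h^{\mu\nu}_{m_1}\mathfrak h^{\rho\sigma}_{m_2}\mathfrak v_{m_3},\\ {}_5\mathfrak m_n&=T_{\rho\sigma\kappa}\,\boldsymbol\Gamma_{\mu\nu\lambda}(p_1)\sum_{m_1+\cdots+m_4=n-1}(-1)^{m_1+m_2+m_3}\mathfrak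 h^{\mu\nu}_{m_1}\mathfrak h^{\rho\sigma}_{m_2}\mathfrak h^{\kappa\lambda}_{m_3}\mathfrak v_{m_4},\\ {}_6\mathfrak m_n&=T_{\kappa\iota}\,\boldsymbol\Gamma_{\mu\nu\lambda}(p_1)\boldsymbol\Gamma_{\rho\sigma\tau}(p_2)\sum_{m_1+\cdots+m_5=n-2}(-1)^{m_1+m_2+m_3+m_4}\mathfrak h^{\mu\nu}_{m_1}\mathfrak h^{\rho\sigma}_{m_2}\mathfrak h^{\kappa\lambda}_{m_3}\mathfrak h^{\iota\tau}_{m_4}\mathfrak v_{m_5},\\ {}_7\mathfrak m_n&=T_o\sum_{m_1+m_2=n}\tbinom{1/2}{m_1}\eta_{0\upsilon}\mathfrak h^{\upsilon o}_{m_1}\mathfrak v_{m_2},\\ {}_8\mathfrak m_n&=T_{o\rho r}\sum_{m_1+m_2+m_3=n}\tbinom{1/2}{m_1}\tbinom{-1/2}{m_2}\eta_{0\upsilon}\mathfrak h^{\upsilon o}_{m_1}\mathfrak h^{\rho r}_{m_2}\mathfrak v_{m_3},\\ {}_9\mathfrak m_n&=T_{orst}\sum_{m_1+\cdots+m_5=n}\tbinom{1/2}{m_1}\tbinom{-1/2}{m_2}\tbinom{-1/2}{m_3}\tbinom{1/2}{m_4}\eta_{0\upsilon}\mathfrak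 h^{\upsilon o}_{m_1}\mathfrak h^{\rho r}_{m_2}\mathfrak h^{\sigma s}_{m_3}\eta_{\sigma\tau}(\mathfrak h'_{m_4})_\rho^{\tau t}\mathfrak v_{m_5},\\ {}_{10}\mathfrak m_n&=T_{orst}\,\boldsymbol\Gamma_{\rho\sigma\tau}(p_1)\sum_{m_1+\cdots+m_5=n-1}\tbinom{1/2}{m_1}\tbinom{-1/2}{m_2}\tbinom{-1/2}{m_3}\tbinom{-1/2}{m_4}\eta_{0\upsilon}\mathfrak h^{\upsilon o}_{m_1}\mathfrak h^{\rho r}_{m_2}\mathfrak h^{\sigma s}_{m_3}\mathfrak h^{\tau t}_{m_4}\mathfrak v_{m_5}. \end{aligned}$$ For a block of $m$ gravitons with indices and momenta renumbered $1,\dots,m$, and $\mu_0:=\mu$, $\nu_{m+1}:=\nu$, $$\mathfrak h_m^{\mu\nu}=\varkappa^m\prod_{a=0}^m\eta^{\mu_a\nu_{a+1}},\qquad(\mathfrak h'_m)_\rho^{\mu\nu}=\varkappa^m\Big(\sum_{a=1}^m p^a_\rho\Big)\prod_{a=0}^m\eta^{\mu_a\nu_{a+1}},$$ and for a single graviton of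 indices $\mu_1\nu_1$ and momentum $p$, $$\boldsymbol\Gamma_{\mu\nu\rho}(p)=\tfrac{\varkappa}{4}\big(p_\mu(\delta_\rho^{\mu_1}\delta_\nu^{\nu_1}+\delta_\nu^{\mu_1}\delta_\rho^{\nu_1})+p_\nu(\delta_\mu^{\mu_1}\delta_\rho^{\nu_1}+\delta_\rho^{\mu_1}\delta_\mu^{\nu_1})-p_\rho(\delta_\mu^{\mu_1}\delta_\nu^{\nu_1}+\delta_\nu^{\mu_1}\delta_\mu^{\nu_1})\big).$$ Finally $$\begin{aligned}\mathfrak v_m=\varkappa^m&\sum_{\substack{i+j+k+l=m\\ i\ge j\ge k\ge l\ge0}}\ \sum_{p=0}^{j-k}\sum_{q=0}^{k-l}\sum_{r=0}^{q}\sum_{s=0}^{l}\sum_{t=0}^{s}\sum_{u=0}^{t}\sum_{v=0}^{u}\tbinom{1/2}{i}\tbinom ij\tbinom jk\tbinom kl\tbinom{j-k}p\tbinom{k-l}q\tbinom qr\tbinom ls\tbinom st\tbinom tu\tbinom uv\\&\times(-1)^{p+q-r+s-t+v}\,2^{-j-2l+r+s+2t-3u+v}\,3^{-k+q-r+s-t+u}\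 \Pi(\boldsymbol a,\boldsymbol b,\boldsymbol c,\boldsymbol d)\end{aligned}$$ with $\boldsymbol a=i+j+k+l-2p-2q-r-2s-t-u$, $\boldsymbol b=p+q-r+s-t+2u-2v$, $\boldsymbol c=r+t-u$, $\boldsymbol d=v$ and $$\begin{aligned}\Pi(\boldsymbol a,\boldsymbol b,\boldsymbol c,\boldsymbol d)=&\prod_{a=1}^{\boldsymbol a}\eta^{\mu_a\nu_a}\prod_{b=\boldsymbol a+1}^{\boldsymbol a+\boldsymbol b}\eta^{\mu_b\mu_{b+\boldsymbol b}}\eta^{\nu_b\nu_{b+\boldsymbol b}}\prod_{c=\boldsymbol a+2\boldsymbol b+1}^{\boldsymbol a+2\boldsymbol b+\boldsymbol c}\eta^{\mu_c\nu_{c+\boldsymbol c}}\eta^{\mu_{c+\boldsymbol c}\nu_{c+2\boldsymbol c}}\eta^{\mu_{c+2\boldsymbol c}\nu_c}\\&\times\prod_{d=\boldsymbol a+2\boldsymbol b+3\boldsymbol c+1}^{\boldsymbol a+2\boldsymbol b+3\boldsymbol c+\boldsymbol d}\eta^{\mu_d\nu_{d+\boldsymbol d}}\eta^{\mu_{d+\boldsymbol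 d}\nu_{d+2\boldsymbol d}}\eta^{\mu_{d+2\boldsymbol d}\nu_{d+3\boldsymbol d}}\eta^{\mu_{d+3\boldsymbol d}\nu_d}.\end{aligned}$$ -/

import Mathlib

noncomputable section

namespace GravitonMatter

/-! ### Background Minkowski spacetime, fields -/

/-- Points of Minkowski spacetime, in the coordinates `(t, x, y, z)`. -/
abbrev Spacetime := Fin 4 → ℝ

/-- `4 × 4` matrices; complex, because the fields are evaluated on Fourier modes. -/
abbrev Mat := Matrix (Fin 4) (Fin 4) ℂ

/-- (0,2)-tensor fields on Minkowski spacetime, by components: metrics and graviton fields. -/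
abbrev TensorField := Spacetime → Mat

/-- The Minkowski metric `diag (1, -1, -1, -1)`. Its inverse has the same components. -/
def eta : Mat := Matrix.diagonal ![1, -1, -1, -1]

/-- The partial derivative `∂_μ f`. -/
def pderiv (μ : Fin 4) (f : Spacetime → ℂ) (x : Spacetime) : ℂ :=
  fderiv ℝ f x (Pi.single μ 1)

/-! ### Metric dependent objects -/

/-- The Christoffel symbols
`Γ_{μν}^τ = ½ g^{τσ} (∂_μ g_{σν} + ∂_ν g_{μσ} - ∂_σ g_{μν})`. -/
def christoffel (g : TensorField) (μ ν τ : Fin 4) (x : Spacetime) : ℂ :=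
  (1 / 2) * ∑ σ, (g x)⁻¹ τ σ *
    (pderiv μ (fun y => g y σ ν) x + pderiv ν (fun y => g y μ σ) x
      - pderiv σ (fun y => g y μ ν) x)

/-- `e` (row: flat index `m`, column: curved index `μ`, so `e m μ` is `e_μ^m`) is the vielbein of
`g`: it solves `g_{μν} = η_{mn} e_μ^m e_ν^n` in the symmetric gauge `e_{μm} = e_{mμ}`, and among the
symmetric solutions it is the one on the branch of the identity, that is, the principal square root
of `η⁻¹ g`. -/
def IsVielbein (g e : Mat) : Prop :=
  e.transpose * eta * e = g ∧ (eta * e).IsSymm ∧ ∀ z ∈ spectrum ℂ e, 0 < z.re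

/-- The vielbein `e_μ^m = vielbein g m μ` of the metric `g` (an arbitrary matrix if there is none;
this does not happen for metrics close to the Minkowski metric). -/
def vielbein (g : Mat) : Mat :=
  Classical.epsilon (IsVielbein g)

/-- The inverse vielbein with raised flat index, `e^{ρr} = e^ρ_s η^{sr}`. -/
def invVielbein (g : Mat) (ρ r : Fin 4) : ℂ :=
  ((vielbein g)⁻¹ * eta) ρ r

/-- `√(-det g)`, the density of the volume form `dV_g` with respect to `dt ∧ dx ∧ dy ∧ dz`. -/
def volDensity (g : Mat) : ℂ :=
  (-g.det) ^ (1 / 2 : ℂ)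

/-! ### The ten matter-model Lagrange densities -/

/-- The ten types of matter-model Lagrange densities. -/
inductive MatterType
  | type1 | type2 | type3 | type4 | type5 | type6 | type7 | type8 | type9 | type10

/-- The number of indices of the matter tensor of each type. -/
def MatterType.rank : MatterType → ℕ
  | type1 => 0
  | type2 => 2
  | type3 => 4
  | type4 => 1
  | type5 => 3
  | type6 => 2
  | type7 => 1
  | type8 => 3
  | type9 => 4
  | type10 => 4

/-- The components of a matter tensor `_kT`. -/
abbrev MatterTensor (k : MatterType) := (Fin k.rank → Fin 4) → ℂ

/-- The scalar factor multiplying the volume form in the Lagrange density of type `k`. -/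
def matterScalar : (k : MatterType) → TensorField → (Spacetime → MatterTensor k) → Spacetime → ℂ
  | .type1, _, T, x => T x ![]
  | .type2, g, T, x => ∑ μ, ∑ ν, (g x)⁻¹ μ ν * T x ![μ, ν]
  | .type3, g, T, x => ∑ μ, ∑ ν, ∑ ρ, ∑ σ, (g x)⁻¹ μ ν * (g x)⁻¹ ρ σ * T x ![μ, ν, ρ, σ]
  | .type4, g, T, x => ∑ μ, ∑ ν, ∑ τ, (g x)⁻¹ μ ν * christoffel g μ ν τ x * T x ![τ]
  | .type5, g, T, x => ∑ μ, ∑ ν, ∑ ρ, ∑ σ, ∑ τ,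
      (g x)⁻¹ μ ν * (g x)⁻¹ ρ σ * christoffel g μ ν τ x * T x ![ρ, σ, τ]
  | .type6, g, T, x => ∑ μ, ∑ ν, ∑ ρ, ∑ σ, ∑ κ, ∑ l,
      (g x)⁻¹ μ ν * (g x)⁻¹ ρ σ * christoffel g μ ν κ x * christoffel g ρ σ l x * T x ![κ, l]
  | .type7, g, T, x => ∑ o, vielbein (g x) o 0 * T x ![o]
  | .type8, g, T, x => ∑ o, ∑ ρ, ∑ r,
      vielbein (g x) o 0 * invVielbein (g x) ρ r * T x ![o, ρ, r]
  | .type9, g, T, x => ∑ o, ∑ ρ, ∑ r, ∑ σ, ∑ s, ∑ t,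
      vielbein (g x) o 0 * invVielbein (g x) ρ r * invVielbein (g x) σ s *
        pderiv ρ (fun y => vielbein (g y) t σ) x * T x ![o, r, s, t]
  | .type10, g, T, x => ∑ o, ∑ ρ, ∑ r, ∑ σ, ∑ s, ∑ τ, ∑ t,
      vielbein (g x) o 0 * invVielbein (g x) ρ r * invVielbein (g x) σ s *
        vielbein (g x) t τ * christoffel g ρ σ τ x * T x ![o, r, s, t]

/-- The Lagrange density of type `k`, as a density with respect to `dt ∧ dx ∧ dy ∧ dz`. -/
def matterLagrangian (k : MatterType) (g : TensorField) (T : Spacetime → MatterTensor k)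
    (x : Spacetime) : ℂ :=
  matterScalar k g T x * volDensity (g x)

/-- The part of order `ϰ^n` of the Lagrange density for the metric `g = η + ϰ h`: the term of
degree `n` of its Taylor series in `ϰ`. -/
def orderPart (k : MatterType) (n : ℕ) (ϰ : ℝ) (h : TensorField) (T : Spacetime → MatterTensor k)
    (x : Spacetime) : ℂ :=
  (ϰ : ℂ) ^ n / n.factorial *
    iteratedDeriv n (fun c : ℂ => matterLagrangian k (fun y => eta + c • h y) T x) 0

/-- The symmetrized extension of the part of order `ϰ^n` to `n` distinguishable gravitons
`h 0, …, h (n-1)`: its full polarization, i.e. the mixed derivative `∂/∂c_0 ⋯ ∂/∂c_{n-1}` at `0` of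
its value at `c_0 h_0 + ⋯ + c_{n-1} h_{n-1}`. -/
def distinguishable (k : MatterType) (n : ℕ) (ϰ : ℝ) (h : Fin n → TensorField)
    (T : Spacetime → MatterTensor k) (x : Spacetime) : ℂ :=
  iteratedFDeriv ℂ n
    (fun c : Fin n → ℂ => orderPart k n ϰ (fun y => ∑ j, c j • h j y) T x) 0
    (fun j => Pi.single j 1)

/-! ### Feynman rules -/

/-- An external graviton: its Lorentz indices `μ`, `ν` and its incoming momentum `p^σ`. -/
structure Leg where
  μ : Fin 4
  ν : Fin 4
  p : Fin 4 → ℂ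

/-- The covariant components `p_μ = η_{μσ} p^σ`. -/
def lower (p : Fin 4 → ℂ) (μ : Fin 4) : ℂ := ∑ σ, eta μ σ * p σ

/-- The Fourier mode of momentum `p`, in the normalization in which `∂_μ` acts on it as
multiplication by `p_μ`. For `p = i k` with `k` real it is the plane wave `exp (i k_μ x^μ)`. -/
def mode (p : Fin 4 → ℂ) (x : Spacetime) : ℂ :=
  Complex.exp (∑ μ, lower p μ * (x μ : ℂ))

/-- The Kronecker delta. -/
def delta (μ ν : Fin 4) : ℂ := if μ = ν then 1 else 0

/-- The direction of the symmetrized functional derivative with respect to the Fourier mode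
`ĥ_{μν}(p)`: the graviton field
`½ (δ_ρ^μ δ_σ^ν + δ_σ^μ δ_ρ^ν) exp (p_λ x^λ)`. -/
def gravitonMode (a : Leg) : TensorField := fun x => Matrix.of fun ρ σ =>
  (1 / 2) * (delta ρ a.μ * delta σ a.ν + delta σ a.μ * delta ρ a.ν) * mode a.p x

/-- The graviton-matter `n`-point vertex Feynman rule of type `k`, contracted with the matter tensor
`T`: `i` times the matrix element of the part of order `ϰ^n` of the Lagrange density, extended to
`n` distinguishable gravitons, between the graviton modes `a 0, …, a (n-1)` and a matter mode
of momentum `q`. The matrix element is read off at the point `x` by stripping the mode of the total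
momentum. -/
def vertexRule (k : MatterType) (n : ℕ) (ϰ : ℝ) (T : MatterTensor k) (q : Fin 4 → ℂ)
    (a : Fin n → Leg) (x : Spacetime) : ℂ :=
  Complex.I * (mode (q + ∑ j, (a j).p) x)⁻¹ *
    distinguishable k n ϰ (fun j => gravitonMode (a j)) (fun y => mode q y • T) x

/-! ### The building blocks of the unsymmetrized rules

Here the gravitons are listed as `a 0, a 1, a 2, …`; a block of `m` of them that starts at position
`b` is passed as `fun i => a (b + i)`. -/

/-- `∏_{i=0}^{m} η^{μ_i ν_{i+1}}`, where `μ_0 = μ`, `ν_{m+1} = ν` and graviton number `i ≥ 1` is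
`a (i - 1)`. -/
def chain (m : ℕ) (μ ν : Fin 4) (a : ℕ → Leg) : ℂ :=
  ∏ i ∈ Finset.range (m + 1),
    eta (if i = 0 then μ else (a (i - 1)).μ) (if i = m then ν else (a i).ν)

/-- `𝔥_m^{μν ⦀ μ₁ν₁|⋯|μ_mν_m}`. -/
def hRule (ϰ : ℝ) (m : ℕ) (μ ν : Fin 4) (a : ℕ → Leg) : ℂ :=
  (ϰ : ℂ) ^ m * chain m μ ν a

/-- `(𝔥'_m)_ρ^{μν ⦀ μ₁ν₁|⋯|μ_mν_m} (p₁, …, p_m)`. -/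
def hRule' (ϰ : ℝ) (m : ℕ) (ρ μ ν : Fin 4) (a : ℕ → Leg) : ℂ :=
  (ϰ : ℂ) ^ m * (∑ i ∈ Finset.range m, lower (a i).p ρ) * chain m μ ν a

/-- The linearized Christoffel symbol `𝚪^{μ₁ν₁}_{μνρ} (p₁)`. -/
def gammaRule (ϰ : ℝ) (μ ν ρ : Fin 4) (a : Leg) : ℂ :=
  (ϰ : ℂ) / 4 *
    (lower a.p μ * (delta ρ a.μ * delta ν a.ν + delta ν a.μ * delta ρ a.ν)
      + lower a.p ν * (delta μ a.μ * delta ρ a.ν + delta ρ a.μ * delta μ a.ν)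
      - lower a.p ρ * (delta μ a.μ * delta ν a.ν + delta ν a.μ * delta μ a.ν))

/-- The product of `A` traces of one, `B` of two, `C` of three and `D` of four gravitons. -/
def traces (A B C D : ℕ) (a : ℕ → Leg) : ℂ :=
  (∏ i ∈ Finset.range A, eta (a i).μ (a i).ν) *
  (∏ i ∈ Finset.range B,
    eta (a (A + i)).μ (a (A + i + B)).μ * eta (a (A + i)).ν (a (A + i + B)).ν) *
  (∏ i ∈ Finset.range C,
    eta (a (A + 2 * B + i)).μ (a (A + 2 * B + i + C)).ν *
    eta (a (A + 2 * B + i + C)).μ (a (A + 2 * B + i + 2 * C)).ν *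
    eta (a (A + 2 * B + i + 2 * C)).μ (a (A + 2 * B + i)).ν) *
  (∏ i ∈ Finset.range D,
    eta (a (A + 2 * B + 3 * C + i)).μ (a (A + 2 * B + 3 * C + i + D)).ν *
    eta (a (A + 2 * B + 3 * C + i + D)).μ (a (A + 2 * B + 3 * C + i + 2 * D)).ν *
    eta (a (A + 2 * B + 3 * C + i + 2 * D)).μ (a (A + 2 * B + 3 * C + i + 3 * D)).ν *
    eta (a (A + 2 * B + 3 * C + i + 3 * D)).μ (a (A + 2 * B + 3 * C + i)).ν)

/-- The generalized binomial coefficient `binom(1/2, m)`. -/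
def binomHalf (m : ℕ) : ℂ := Ring.choose (1 / 2 : ℂ) m

/-- The generalized binomial coefficient `binom(-1/2, m)`. -/
def binomNegHalf (m : ℕ) : ℂ := Ring.choose (-1 / 2 : ℂ) m

/-- The volume form coefficient `𝔳_m^{μ₁ν₁|⋯|μ_mν_m}`. In the ranges of summation all the
subtractions of natural numbers below are exact. -/
def vRule (ϰ : ℝ) (m : ℕ) (a : ℕ → Leg) : ℂ :=
  (ϰ : ℂ) ^ m *
  ∑ i ∈ Finset.range (m + 1), ∑ j ∈ Finset.range (i + 1),
  ∑ k ∈ Finset.range (j + 1), ∑ l ∈ Finset.range (k + 1),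
  if i + j + k + l = m then
    ∑ p ∈ Finset.range (j - k + 1), ∑ q ∈ Finset.range (k - l + 1), ∑ r ∈ Finset.range (q + 1),
    ∑ s ∈ Finset.range (l + 1), ∑ t ∈ Finset.range (s + 1), ∑ u ∈ Finset.range (t + 1),
    ∑ v ∈ Finset.range (u + 1),
      binomHalf i *
      (i.choose j * j.choose k * k.choose l * (j - k).choose p * (k - l).choose q * q.choose r *
        l.choose s * s.choose t * t.choose u * u.choose v : ℕ) *
      (-1) ^ (p + (q - r) + (s - t) + v) *
      (2 : ℂ) ^ (-(j : ℤ) - 2 * l + r + s + 2 * t - 3 * u + v) *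
      (3 : ℂ) ^ (-(k : ℤ) + q - r + s - t + u) *
      traces (i + j + k + l - (2 * p + 2 * q + r + 2 * s + t + u))
        (p + (q - r) + (s - t) + 2 * (u - v)) (r + (t - u)) v a
  else 0

/-- The tuples `(m₁, …, m_r)` of natural numbers with `m₁ + ⋯ + m_r = n - d`; there are none if
`n < d`. -/
def splittings (r n d : ℕ) : Finset (Fin r → ℕ) :=
  if d ≤ n then Finset.Nat.antidiagonalTuple r (n - d) else ∅

/-- The unsymmetrized rule `_k𝔪_n^{μ₁ν₁|⋯|μ_nν_n} (T; p₁, …, p_n)`, where graviton number `i`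
is `a (i - 1)`. -/
def mRule (ϰ : ℝ) (n : ℕ) : (k : MatterType) → MatterTensor k → (ℕ → Leg) → ℂ
  | .type1, T, a => T ![] * vRule ϰ n a
  | .type2, T, a => ∑ μ, ∑ ν, T ![μ, ν] *
      ∑ m ∈ splittings 2 n 0, (-1) ^ (m 0) *
        hRule ϰ (m 0) μ ν a *
        vRule ϰ (m 1) (fun i => a (m 0 + i))
  | .type3, T, a => ∑ μ, ∑ ν, ∑ ρ, ∑ σ, T ![μ, ν, ρ, σ] *
      ∑ m ∈ splittings 3 n 0, (-1) ^ (m 0 + m 1) *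
        hRule ϰ (m 0) μ ν a *
        hRule ϰ (m 1) ρ σ (fun i => a (m 0 + i)) *
        vRule ϰ (m 2) (fun i => a (m 0 + m 1 + i))
  | .type4, T, a => ∑ μ, ∑ ν, ∑ ρ, ∑ σ, T ![ρ] * gammaRule ϰ μ ν σ (a 0) *
      ∑ m ∈ splittings 3 n 1, (-1) ^ (m 0 + m 1) *
        hRule ϰ (m 0) μ ν (fun i => a (1 + i)) *
        hRule ϰ (m 1) ρ σ (fun i => a (1 + m 0 + i)) *
        vRule ϰ (m 2) (fun i => a (1 + m 0 + m 1 + i))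
  | .type5, T, a => ∑ μ, ∑ ν, ∑ ρ, ∑ σ, ∑ κ, ∑ l,
      T ![ρ, σ, κ] * gammaRule ϰ μ ν l (a 0) *
      ∑ m ∈ splittings 4 n 1, (-1) ^ (m 0 + m 1 + m 2) *
        hRule ϰ (m 0) μ ν (fun i => a (1 + i)) *
        hRule ϰ (m 1) ρ σ (fun i => a (1 + m 0 + i)) *
        hRule ϰ (m 2) κ l (fun i => a (1 + m 0 + m 1 + i)) *
        vRule ϰ (m 3) (fun i => a (1 + m 0 + m 1 + m 2 + i))
  | .type6, T, a => ∑ μ, ∑ ν, ∑ ρ, ∑ σ, ∑ κ, ∑ l, ∑ ι, ∑ τ,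
      T ![κ, ι] * gammaRule ϰ μ ν l (a 0) * gammaRule ϰ ρ σ τ (a 1) *
      ∑ m ∈ splittings 5 n 2, (-1) ^ (m 0 + m 1 + m 2 + m 3) *
        hRule ϰ (m 0) μ ν (fun i => a (2 + i)) *
        hRule ϰ (m 1) ρ σ (fun i => a (2 + m 0 + i)) *
        hRule ϰ (m 2) κ l (fun i => a (2 + m 0 + m 1 + i)) *
        hRule ϰ (m 3) ι τ (fun i => a (2 + m 0 + m 1 + m 2 + i)) *
        vRule ϰ (m 4) (fun i => a (2 + m 0 + m 1 + m 2 + m 3 + i))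
  | .type7, T, a => ∑ o, ∑ υ, T ![o] *
      ∑ m ∈ splittings 2 n 0, binomHalf (m 0) *
        eta 0 υ * hRule ϰ (m 0) υ o a *
        vRule ϰ (m 1) (fun i => a (m 0 + i))
  | .type8, T, a => ∑ o, ∑ ρ, ∑ r, ∑ υ, T ![o, ρ, r] *
      ∑ m ∈ splittings 3 n 0, binomHalf (m 0) * binomNegHalf (m 1) *
        eta 0 υ * hRule ϰ (m 0) υ o a *
        hRule ϰ (m 1) ρ r (fun i => a (m 0 + i)) *
        vRule ϰ (m 2) (fun i => a (m 0 + m 1 + i))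
  | .type9, T, a => ∑ o, ∑ r, ∑ s, ∑ t, ∑ υ, ∑ ρ, ∑ σ, ∑ τ, T ![o, r, s, t] *
      ∑ m ∈ splittings 5 n 0,
        binomHalf (m 0) * binomNegHalf (m 1) * binomNegHalf (m 2) * binomHalf (m 3) *
        eta 0 υ * hRule ϰ (m 0) υ o a *
        hRule ϰ (m 1) ρ r (fun i => a (m 0 + i)) *
        hRule ϰ (m 2) σ s (fun i => a (m 0 + m 1 + i)) *
        eta σ τ * hRule' ϰ (m 3) ρ τ t (fun i => a (m 0 + m 1 + m 2 + i)) *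
        vRule ϰ (m 4) (fun i => a (m 0 + m 1 + m 2 + m 3 + i))
  | .type10, T, a => ∑ o, ∑ r, ∑ s, ∑ t, ∑ υ, ∑ ρ, ∑ σ, ∑ τ,
      T ![o, r, s, t] * gammaRule ϰ ρ σ τ (a 0) *
      ∑ m ∈ splittings 5 n 1,
        binomHalf (m 0) * binomNegHalf (m 1) * binomNegHalf (m 2) * binomNegHalf (m 3) *
        eta 0 υ * hRule ϰ (m 0) υ o (fun i => a (1 + i)) *
        hRule ϰ (m 1) ρ r (fun i => a (1 + m 0 + i)) *
        hRule ϰ (m 2) σ s (fun i => a (1 + m 0 + m 1 + i)) *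
        hRule ϰ (m 3) τ t (fun i => a (1 + m 0 + m 1 + m 2 + i)) *
        vRule ϰ (m 4) (fun i => a (1 + m 0 + m 1 + m 2 + m 3 + i))

/-! ### Symmetrization -/

/-- Exchange the two Lorentz indices of a graviton if `b` is true. -/
def Leg.swapIf (b : Bool) (a : Leg) : Leg :=
  if b then ⟨a.ν, a.μ, a.p⟩ else a

/-- A finite list of gravitons as a sequence; the entries from position `n` on are never used. -/
def toSeq {n : ℕ} (a : Fin n → Leg) (i : ℕ) : Leg :=
  if h : i < n then a ⟨i, h⟩ else ⟨0, 0, 0⟩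

end GravitonMatter

end

/-!
Fix a superposition `h = ∑ j, c j • h j` of graviton modes and the metric `η + z h`. Every factor of
the Lagrange densities is analytic in `z` near `0`, and the proof computes its Taylor coefficients
as values of rules. A rule is a function of a list of legs, and `legSum` extends it multilinearly
from single legs to the field `h`; products of series then correspond to concatenation of rules
(`legSum_mul_shift`, `HasExpansion.mul`), which is the attachment of consecutive blocks of gravitons
to the factors. Both orders of the two Lorentz indices are separate legs of weight one half,
whence the sum over exchanges and the factor `1 / 2 ^ n`.

* The matrix `X = η h` satisfies `(X ^ m η)^{μν} = 𝔥_m^{μν}` (`legSum_chain`). For small `X` the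
  binomial series `(1 + X) ^ α` converge and multiply as they should. Their exponents `-1`, `1 / 2`,
  `-1 / 2` give the inverse metric, the vielbein and the inverse vielbein. For the vielbein one needs
  that the symmetric gauge condition together with the position of the spectrum determines the square
  root (`eq_of_mul_self_eq_of_commute`, `vielbein_eq`).
* Derivatives of the vielbein are taken termwise; a product of modes is multiplied by its total
  momentum (`hasFDerivAt_legSum`, `hasSum_pderiv_binomSum`).
* In `e_τ^t Γ_{ρσ}^τ` the vielbein and the inverse metric combine to the inverse vielbein, by the
  symmetric gauge (`vielbein_mul_inv_metric`).
* The volume density is `det (1 + X) ^ (1 / 2)`. Newton's identities express the determinant by the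
  traces of `X, …, X ^ 4`, and repeated binomial expansion of the powers of `det (1 + X) - 1` gives
  the sevenfold sum in `𝔳_m` (`det_one_add_smul`, `coeff_pow_quartic`, `legSum_vRule`). The
  products of traces interleave their gravitons, which is harmless after evaluation at one field
  (`legSum_prod_stride`).

The part of order `n` is thereby a homogeneous polynomial in the amplitudes `c`, given as a sum over
words of length `n` in the gravitons. Its full polarization keeps the words in which every graviton
occurs once, that is, the sum over permutations (`iteratedFDeriv_sum_words`).
-/


noncomputable section

namespace GravitonMatter

open Finset Filter Topology

/-! ### Taylor series at the origin -/

/-- The formal power series `φ` converges to `F` on a neighbourhood of `0`. -/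
def HasTaylor (F : ℂ → ℂ) (φ : PowerSeries ℂ) : Prop :=
  ∀ᶠ z in 𝓝 (0 : ℂ), HasSum (fun n => φ.coeff n * z ^ n) (F z)

theorem hasTaylor_iff {F : ℂ → ℂ} {φ : PowerSeries ℂ} :
    HasTaylor F φ ↔
      HasFPowerSeriesAt F (FormalMultilinearSeries.ofScalars ℂ fun n => φ.coeff n) 0 := by
  rw [hasFPowerSeriesAt_iff]
  simp only [HasTaylor, FormalMultilinearSeries.coeff_ofScalars, smul_eq_mul, zero_add, mul_comm]

theorem HasTaylor.congr {F G : ℂ → ℂ} {φ : PowerSeries ℂ} (h : HasTaylor F φ)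
    (hFG : ∀ᶠ z in 𝓝 (0 : ℂ), F z = G z) : HasTaylor G φ := by
  filter_upwards [h, hFG] with z hz hz'
  rwa [← hz']

theorem HasTaylor.analyticAt {F : ℂ → ℂ} {φ : PowerSeries ℂ} (h : HasTaylor F φ) :
    AnalyticAt ℂ F 0 :=
  (hasTaylor_iff.1 h).analyticAt

theorem exists_hasTaylor {F : ℂ → ℂ} (h : AnalyticAt ℂ F 0) : ∃ φ, HasTaylor F φ :=
  ⟨PowerSeries.mk fun n => iteratedDeriv n F 0 / n.factorial, by
    rw [hasTaylor_iff]
    simpa only [PowerSeries.coeff_mk] using h.hasFPowerSeriesAt⟩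

theorem HasTaylor.unique {F : ℂ → ℂ} {φ ψ : PowerSeries ℂ} (h : HasTaylor F φ)
    (h' : HasTaylor F ψ) : φ = ψ := by
  have := (hasTaylor_iff.1 h).eq_formalMultilinearSeries (hasTaylor_iff.1 h')
  ext n
  have h2 := congrArg (fun p => FormalMultilinearSeries.coeff p n) this
  simpa only [FormalMultilinearSeries.coeff_ofScalars] using h2

theorem HasTaylor.iteratedDeriv_eq {F : ℂ → ℂ} {φ : PowerSeries ℂ} (h : HasTaylor F φ) (n : ℕ) :
    iteratedDeriv n F 0 = n.factorial * φ.coeff n := by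
  have h1 : HasTaylor F (PowerSeries.mk fun n => iteratedDeriv n F 0 / n.factorial) := by
    rw [hasTaylor_iff]
    simpa only [PowerSeries.coeff_mk] using h.analyticAt.hasFPowerSeriesAt
  rw [h.unique h1, PowerSeries.coeff_mk]
  have : (n.factorial : ℂ) ≠ 0 := by exact_mod_cast n.factorial_ne_zero
  field_simp

theorem hasTaylor_const (c : ℂ) : HasTaylor (fun _ => c) (PowerSeries.C c) := by
  refine Eventually.of_forall fun z => ?_
  convert hasSum_ite_eq 0 c using 2 with n
  rw [PowerSeries.coeff_C]
  split_ifs with h <;> simp [h]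

theorem hasTaylor_id : HasTaylor (fun z => z) PowerSeries.X := by
  refine Eventually.of_forall fun z => ?_
  convert hasSum_ite_eq 1 z using 2 with n
  rw [PowerSeries.coeff_X]
  split_ifs with h <;> simp [h]

theorem HasTaylor.add {F G : ℂ → ℂ} {φ ψ : PowerSeries ℂ} (hF : HasTaylor F φ)
    (hG : HasTaylor G ψ) : HasTaylor (fun z => F z + G z) (φ + ψ) := by
  filter_upwards [hF, hG] with z h1 h2
  simpa only [map_add, add_mul] using h1.add h2

theorem HasTaylor.mul {F G : ℂ → ℂ} {φ ψ : PowerSeries ℂ} (hF : HasTaylor F φ)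
    (hG : HasTaylor G ψ) : HasTaylor (fun z => F z * G z) (φ * ψ) := by
  filter_upwards [hF, hG] with z h1 h2
  have s1 := h1.summable.norm
  have s2 := h2.summable.norm
  have s3 := (summable_norm_sum_mul_antidiagonal_of_summable_norm s1 s2).of_norm.hasSum
  rw [← tsum_mul_tsum_eq_tsum_sum_antidiagonal_of_summable_norm s1 s2, h1.tsum_eq, h2.tsum_eq] at s3
  have e : (fun n => PowerSeries.coeff n (φ * ψ) * z ^ n) = fun n => ∑ kl ∈ antidiagonal n,
      φ.coeff kl.1 * z ^ kl.1 * (ψ.coeff kl.2 * z ^ kl.2) := by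
    funext n
    rw [PowerSeries.coeff_mul, Finset.sum_mul]
    refine Finset.sum_congr rfl fun ij hij => ?_
    rw [← mem_antidiagonal.1 hij, pow_add]
    ring
  rw [e]
  exact s3

theorem HasTaylor.sum {ι : Type*} (s : Finset ι) {F : ι → ℂ → ℂ} {φ : ι → PowerSeries ℂ}
    (h : ∀ i ∈ s, HasTaylor (F i) (φ i)) :
    HasTaylor (fun z => ∑ i ∈ s, F i z) (∑ i ∈ s, φ i) := by
  classical
  induction s using Finset.induction_on with
  | empty => simpa using hasTaylor_const 0
  | insert a s ha ih =>
    simp only [Finset.sum_insert ha]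
    exact (h a (by simp)).add (ih fun i hi => h i (by simp [hi]))

theorem HasTaylor.pow {F : ℂ → ℂ} {φ : PowerSeries ℂ} (h : HasTaylor F φ) (n : ℕ) :
    HasTaylor (fun z => F z ^ n) (φ ^ n) := by
  induction n with
  | zero => simpa using hasTaylor_const 1
  | succ n ih => simpa only [pow_succ] using ih.mul h

/-- Substitution of a series without constant term into a convergent power series. Only finitely
many powers contribute to each coefficient, since the Taylor remainder of `G` of order `m + 1`
becomes divisible by `X ^ (m + 1)`. -/
theorem HasTaylor.comp {G u : ℂ → ℂ} {α υ : PowerSeries ℂ} (hG : HasTaylor G α)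
    (hu : HasTaylor u υ) (hυ : PowerSeries.X ∣ υ) :
    HasTaylor (fun z => G (u z))
      (PowerSeries.mk fun m => ∑ i ∈ range (m + 1), α.coeff i * (υ ^ i).coeff m) := by
  have hu0 : u 0 = 0 := by
    have h := hu.iteratedDeriv_eq 0
    obtain ⟨w, rfl⟩ := hυ
    simpa using h
  have hGu : AnalyticAt ℂ (fun z => G (u z)) 0 := by
    refine AnalyticAt.comp (g := G) ?_ hu.analyticAt
    rw [hu0]; exact hG.analyticAt
  obtain ⟨ψ, hψ⟩ := exists_hasTaylor hGu
  suffices h : ψ = PowerSeries.mk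
      fun m => ∑ i ∈ range (m + 1), α.coeff i * (υ ^ i).coeff m by rwa [← h]
  have hutend : Tendsto u (𝓝 0) (𝓝 0) := by
    have := hu.analyticAt.continuousAt
    rwa [ContinuousAt, hu0] at this
  ext m
  rw [PowerSeries.coeff_mk]
  -- the remainder of order `m + 1` of `G`, divided by `w ^ (m + 1)`
  obtain ⟨R, hR⟩ : ∃ R : ℂ → ℂ, HasTaylor R (PowerSeries.mk fun i => α.coeff (i + (m + 1))) := by
    refine ⟨fun w => ∑' i, α.coeff (i + (m + 1)) * w ^ i, ?_⟩
    filter_upwards [hG] with w hw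
    simp only [PowerSeries.coeff_mk]
    refine Summable.hasSum ?_
    by_cases h0 : w = 0
    · subst h0
      refine summable_of_ne_finset_zero (s := {0}) fun i hi => ?_
      rw [zero_pow (by simpa using hi), mul_zero]
    · have h1 := ((summable_nat_add_iff (m + 1)).2 hw.summable).mul_right ((w ^ (m + 1))⁻¹)
      refine h1.congr fun i => ?_
      rw [pow_add]
      field_simp
  have hGR : ∀ᶠ w in 𝓝 (0 : ℂ),
      G w = ∑ i ∈ range (m + 1), α.coeff i * w ^ i + w ^ (m + 1) * R w := by
    filter_upwards [hG, hR] with w h1 h2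
    rw [← h1.tsum_eq, ← h1.summable.sum_add_tsum_nat_add (m + 1), ← h2.tsum_eq, ← tsum_mul_left]
    congr 2
    ext i
    rw [PowerSeries.coeff_mk, pow_add]
    ring
  have hRu : AnalyticAt ℂ (fun z => R (u z)) 0 := by
    refine AnalyticAt.comp (g := R) ?_ hu.analyticAt
    rw [hu0]; exact hR.analyticAt
  obtain ⟨ρ, hρ⟩ := exists_hasTaylor hRu
  have h3 : HasTaylor (fun z => G (u z))
      (∑ i ∈ range (m + 1), PowerSeries.C (α.coeff i) * υ ^ i + υ ^ (m + 1) * ρ) := by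
    refine ((HasTaylor.sum _ fun i _ => (hasTaylor_const (α.coeff i)).mul (hu.pow i)).add
      ((hu.pow (m + 1)).mul hρ)).congr ?_
    filter_upwards [hutend.eventually hGR] with z hz
    rw [hz]
  rw [hψ.unique h3, map_add, map_sum]
  have h4 : PowerSeries.coeff m (υ ^ (m + 1) * ρ) = 0 := by
    have : PowerSeries.X ^ (m + 1) ∣ υ ^ (m + 1) * ρ := (pow_dvd_pow_of_dvd hυ _).mul_right _
    exact PowerSeries.X_pow_dvd_iff.1 this m (Nat.lt_succ_self m)
  rw [h4, add_zero]
  simp only [PowerSeries.coeff_C_mul]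

/-! ### Sums over words of weighted legs -/

/-- The sequence `a` without its first `m` entries. -/
def shift (m : ℕ) (a : ℕ → Leg) : ℕ → Leg := fun i => a (m + i)

/-- `Φ` depends only on the first `m` gravitons. -/
def DependsOnFirst (m : ℕ) (Φ : (ℕ → Leg) → ℂ) : Prop :=
  ∀ a b : ℕ → Leg, (∀ i < m, a i = b i) → Φ a = Φ b

/-- The value of a rule `Φ` for `m` gravitons, extended multilinearly from single legs to the
formal combination `∑ k, wt k • ℓ k` of legs, with this combination in each of the `m` places. -/
def legSum {K : Type*} [Fintype K] (wt : K → ℂ) (ℓ : K → Leg) (m : ℕ) (Φ : (ℕ → Leg) → ℂ) : ℂ :=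
  ∑ f : Fin m → K, (∏ i, wt (f i)) * Φ (toSeq fun i => ℓ (f i))

theorem toSeq_append_of_lt {m n : ℕ} (f : Fin m → Leg) (g : Fin n → Leg) {i : ℕ} (hi : i < m) :
    toSeq (Fin.append f g) i = toSeq f i := by
  have h1 : i < m + n := by omega
  simp only [toSeq, hi, h1, dif_pos]
  exact Fin.append_left f g ⟨i, hi⟩

theorem shift_toSeq_append {m n : ℕ} (f : Fin m → Leg) (g : Fin n → Leg) :
    shift m (toSeq (Fin.append f g)) = toSeq g := by
  funext i
  simp only [toSeq, shift]
  by_cases hi : i < n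
  · have h1 : m + i < m + n := by omega
    simp only [hi, h1, dif_pos]
    exact Fin.append_right f g ⟨i, hi⟩
  · have h1 : ¬ m + i < m + n := by omega
    simp only [hi, h1, dif_neg, not_false_eq_true]

theorem shift_shift (m n : ℕ) (a : ℕ → Leg) : shift m (shift n a) = shift (n + m) a := by
  funext i
  simp only [shift, Nat.add_assoc]

section

variable {K : Type*} [Fintype K] (wt : K → ℂ) (ℓ : K → Leg)

theorem legSum_congr {m : ℕ} {Φ Ψ : (ℕ → Leg) → ℂ} (h : ∀ a, Φ a = Ψ a) :
    legSum wt ℓ m Φ = legSum wt ℓ m Ψ := by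
  rw [funext h]

theorem legSum_zero (Φ : (ℕ → Leg) → ℂ) :
    legSum wt ℓ 0 Φ = Φ (toSeq fun i : Fin 0 => i.elim0) := by
  simp only [legSum, univ_unique, univ_eq_empty, prod_empty, one_mul, sum_singleton]
  congr 2
  funext i
  exact i.elim0

theorem legSum_const_mul (m : ℕ) (c : ℂ) (Φ : (ℕ → Leg) → ℂ) :
    legSum wt ℓ m (fun a => c * Φ a) = c * legSum wt ℓ m Φ := by
  simp only [legSum, mul_sum]
  exact sum_congr rfl fun f _ => by ring

theorem legSum_sum {ι : Type*} (s : Finset ι) (m : ℕ) (Φ : ι → (ℕ → Leg) → ℂ) :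
    legSum wt ℓ m (fun a => ∑ i ∈ s, Φ i a) = ∑ i ∈ s, legSum wt ℓ m (Φ i) := by
  simp only [legSum, mul_sum]
  rw [sum_comm]

theorem legSum_append (m n : ℕ) (Φ : (ℕ → Leg) → ℂ) :
    legSum wt ℓ (m + n) Φ = ∑ f : Fin m → K, ∑ g : Fin n → K,
      (∏ i, wt (f i)) * (∏ i, wt (g i)) *
        Φ (toSeq (Fin.append (fun i => ℓ (f i)) (fun i => ℓ (g i)))) := by
  rw [← Fintype.sum_prod_type', legSum, ← (Fin.appendEquiv m n).sum_comp]
  refine sum_congr rfl fun fg _ => ?_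
  rw [Fin.prod_univ_add]
  simp only [Fin.appendEquiv, Equiv.coe_fn_mk, Fin.append_left, Fin.append_right]
  congr 3
  funext i
  refine Fin.addCases (fun i => ?_) (fun i => ?_) i <;>
    simp only [Fin.append_left, Fin.append_right]

/-- Rules attached to consecutive blocks of gravitons are evaluated independently. -/
theorem legSum_mul_shift {m : ℕ} (n : ℕ) {Φ : (ℕ → Leg) → ℂ} (hΦ : DependsOnFirst m Φ)
    (Ψ : (ℕ → Leg) → ℂ) :
    legSum wt ℓ (m + n) (fun a => Φ a * Ψ (shift m a)) =
      legSum wt ℓ m Φ * legSum wt ℓ n Ψ := by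
  rw [legSum_append, legSum, legSum, sum_mul_sum]
  refine sum_congr rfl fun f _ => sum_congr rfl fun g _ => ?_
  rw [shift_toSeq_append, hΦ _ _ fun i hi => toSeq_append_of_lt _ _ hi]
  ring

theorem legSum_one (φ : Leg → ℂ) :
    legSum wt ℓ 1 (fun a => φ (a 0)) = ∑ k, wt k * φ (ℓ k) := by
  rw [legSum, ← (Equiv.funUnique (Fin 1) K).symm.sum_comp]
  refine sum_congr rfl fun k _ => ?_
  simp [toSeq]

/-! ### Expansions in powers of the coupling constant -/

/-- The concatenation product of two families of rules. -/
def conv (Φ Ψ : ℕ → (ℕ → Leg) → ℂ) (n : ℕ) (a : ℕ → Leg) : ℂ :=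
  ∑ ij ∈ antidiagonal n, Φ ij.1 a * Ψ ij.2 (shift ij.1 a)

/-- `F` is analytic at `0`, and its Taylor coefficients, rescaled by powers of `ϰ`, are the values
of the rules `Φ n` on the graviton field `∑ k, wt k • ℓ k`. -/
def HasExpansion (ϰ : ℝ) (F : ℂ → ℂ) (Φ : ℕ → (ℕ → Leg) → ℂ) : Prop :=
  ∃ φ : PowerSeries ℂ, HasTaylor F φ ∧ ∀ n, (ϰ : ℂ) ^ n * φ.coeff n = legSum wt ℓ n (Φ n)

variable {wt ℓ} {ϰ : ℝ}

theorem HasExpansion.congr {F G : ℂ → ℂ} {Φ : ℕ → (ℕ → Leg) → ℂ}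
    (h : HasExpansion wt ℓ ϰ F Φ) (hFG : ∀ᶠ z in 𝓝 (0 : ℂ), F z = G z) :
    HasExpansion wt ℓ ϰ G Φ :=
  let ⟨φ, h1, h2⟩ := h
  ⟨φ, h1.congr hFG, h2⟩

theorem HasExpansion.congr_rule {F : ℂ → ℂ} {Φ Ψ : ℕ → (ℕ → Leg) → ℂ}
    (h : HasExpansion wt ℓ ϰ F Φ) (hΦ : ∀ n a, Φ n a = Ψ n a) : HasExpansion wt ℓ ϰ F Ψ := by
  rwa [show Ψ = Φ from funext fun n => funext fun a => (hΦ n a).symm]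

theorem HasExpansion.const_mul {F : ℂ → ℂ} {Φ : ℕ → (ℕ → Leg) → ℂ} (c : ℂ)
    (h : HasExpansion wt ℓ ϰ F Φ) :
    HasExpansion wt ℓ ϰ (fun z => c * F z) (fun n a => c * Φ n a) := by
  obtain ⟨φ, h1, h2⟩ := h
  refine ⟨_, (hasTaylor_const c).mul h1, fun n => ?_⟩
  rw [PowerSeries.coeff_C_mul, legSum_const_mul, ← h2]
  ring

theorem HasExpansion.sum {ι : Type*} (s : Finset ι) {F : ι → ℂ → ℂ}
    {Φ : ι → ℕ → (ℕ → Leg) → ℂ} (h : ∀ i ∈ s, HasExpansion wt ℓ ϰ (F i) (Φ i)) :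
    HasExpansion wt ℓ ϰ (fun z => ∑ i ∈ s, F i z) (fun n a => ∑ i ∈ s, Φ i n a) := by
  choose! φ h1 h2 using h
  refine ⟨_, HasTaylor.sum s h1, fun n => ?_⟩
  rw [map_sum, legSum_sum, mul_sum]
  exact sum_congr rfl fun i hi => h2 i hi n

theorem HasExpansion.mul {F G : ℂ → ℂ} {Φ Ψ : ℕ → (ℕ → Leg) → ℂ}
    (hF : HasExpansion wt ℓ ϰ F Φ) (hG : HasExpansion wt ℓ ϰ G Ψ)
    (hΦ : ∀ n, DependsOnFirst n (Φ n)) :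
    HasExpansion wt ℓ ϰ (fun z => F z * G z) (conv Φ Ψ) := by
  obtain ⟨φ, h1, h2⟩ := hF
  obtain ⟨ψ, h3, h4⟩ := hG
  refine ⟨_, h1.mul h3, fun n => ?_⟩
  rw [PowerSeries.coeff_mul, show conv Φ Ψ n = fun a => ∑ ij ∈ antidiagonal n,
    Φ ij.1 a * Ψ ij.2 (shift ij.1 a) from rfl, legSum_sum, mul_sum]
  refine sum_congr rfl fun ij hij => ?_
  rw [← mem_antidiagonal.1 hij, legSum_mul_shift wt ℓ _ (hΦ ij.1), ← h2, ← h4, pow_add]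
  ring

end

/-! ### Binomial series in a Banach algebra -/

theorem choose_succ_eq_mul_div (α : ℂ) (m : ℕ) :
    Ring.choose α (m + 1) = Ring.choose α m * ((α - m) / (m + 1)) := by
  have h1 := Ring.descPochhammer_eq_factorial_smul_choose α (m + 1)
  have h2 := Ring.descPochhammer_eq_factorial_smul_choose α m
  rw [descPochhammer_succ_right, Polynomial.smeval_mul, h2, nsmul_eq_mul, nsmul_eq_mul,
    Nat.factorial_succ] at h1
  have h3 : Polynomial.smeval (Polynomial.X - (m : Polynomial ℤ)) α = α - m := by
    rw [Polynomial.smeval_sub, Polynomial.smeval_X, Polynomial.smeval_natCast]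
    simp
  rw [h3] at h1
  have h4 : (m.factorial : ℂ) ≠ 0 := by exact_mod_cast m.factorial_ne_zero
  have h5 : (m : ℂ) + 1 ≠ 0 := by exact_mod_cast m.succ_ne_zero
  push_cast at h1
  field_simp
  refine mul_left_cancel₀ h4 ?_
  linear_combination -h1

theorem norm_choose_le_one {α : ℂ} (hα : ‖α‖ ≤ 1) (m : ℕ) : ‖Ring.choose α m‖ ≤ 1 := by
  induction m with
  | zero => simp
  | succ m ih =>
    rw [choose_succ_eq_mul_div, norm_mul]
    refine mul_le_one₀ ih (norm_nonneg _) ?_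
    have h5 : ‖(m : ℂ) + 1‖ = m + 1 := by
      have : ((m : ℂ) + 1) = ((m + 1 : ℕ) : ℂ) := by push_cast; ring
      rw [this, Complex.norm_natCast]; push_cast; ring
    rw [norm_div, h5, div_le_one (by positivity)]
    calc ‖α - m‖ ≤ ‖α‖ + ‖(m : ℂ)‖ := norm_sub_le _ _
      _ ≤ m + 1 := by rw [Complex.norm_natCast]; linarith

theorem choose_neg_one (m : ℕ) : Ring.choose (-1 : ℂ) m = (-1) ^ m := by
  induction m with
  | zero => simp
  | succ m ih =>
    rw [choose_succ_eq_mul_div, ih, pow_succ]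
    have h5 : (m : ℂ) + 1 ≠ 0 := by exact_mod_cast m.succ_ne_zero
    field_simp
    ring

section BanachAlgebra

variable {A : Type*} [NormedRing A] [NormedAlgebra ℂ A]

/-- The binomial series `(1 + X) ^ α`. -/
def binomSum (α : ℂ) (X : A) : A := ∑' m : ℕ, Ring.choose α m • X ^ m

theorem binomSum_zero (X : A) : binomSum 0 X = 1 := by
  rw [binomSum, tsum_eq_single 0]
  · simp
  · intro m hm
    rw [Ring.choose_zero_pos ℂ (Nat.pos_of_ne_zero hm), zero_smul]

theorem binomSum_one (X : A) : binomSum 1 X = 1 + X := by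
  have h : ∀ m : ℕ, Ring.choose (1 : ℂ) m = Nat.choose 1 m := fun m => by
    simpa using Ring.choose_natCast (R := ℂ) 1 m
  rw [binomSum, tsum_eq_sum (s := range 2)]
  · simp [sum_range_succ, h]
  · intro m hm
    rw [h, Nat.choose_eq_zero_of_lt (by simpa using hm)]
    simp

theorem commute_binomSum (α : ℂ) {X Y : A} (h : Commute Y X) : Commute Y (binomSum α X) :=
  Commute.tsum_right _ fun m => (h.pow_right m).smul_right _

variable [NormOneClass A]

theorem norm_binomSum_term_le {α : ℂ} (hα : ‖α‖ ≤ 1) (X : A) (m : ℕ) :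
    ‖Ring.choose α m • X ^ m‖ ≤ ‖X‖ ^ m := by
  rw [norm_smul]
  calc _ ≤ 1 * ‖X‖ ^ m :=
        mul_le_mul (norm_choose_le_one hα m) (norm_pow_le X m) (norm_nonneg _) zero_le_one
    _ = _ := one_mul _

theorem summable_norm_binomSum {α : ℂ} (hα : ‖α‖ ≤ 1) {X : A} (hX : ‖X‖ < 1) :
    Summable fun m : ℕ => ‖Ring.choose α m • X ^ m‖ :=
  Summable.of_nonneg_of_le (fun _ => norm_nonneg _) (norm_binomSum_term_le hα X)
    (summable_geometric_of_lt_one (norm_nonneg _) hX)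

variable [CompleteSpace A]

theorem hasSum_binomSum {α : ℂ} (hα : ‖α‖ ≤ 1) {X : A} (hX : ‖X‖ < 1) :
    HasSum (fun m : ℕ => Ring.choose α m • X ^ m) (binomSum α X) :=
  (summable_norm_binomSum hα hX).of_norm.hasSum

theorem binomSum_mul {α β : ℂ} (hα : ‖α‖ ≤ 1) (hβ : ‖β‖ ≤ 1) {X : A} (hX : ‖X‖ < 1) :
    binomSum α X * binomSum β X = binomSum (α + β) X := by
  rw [binomSum, binomSum, tsum_mul_tsum_eq_tsum_sum_antidiagonal_of_summable_norm
    (summable_norm_binomSum hα hX) (summable_norm_binomSum hβ hX), binomSum]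
  refine tsum_congr fun m => ?_
  rw [Ring.add_choose_eq m (Commute.all α β), sum_smul]
  refine sum_congr rfl fun ij hij => ?_
  rw [smul_mul_smul_comm, ← pow_add, mem_antidiagonal.1 hij]

/-- The distance to `1` is at most the geometric sum `‖X‖ / (1 - ‖X‖)`. -/
theorem norm_binomSum_sub_one_lt {α : ℂ} (hα : ‖α‖ ≤ 1) {X : A} (hX : ‖X‖ < 1 / 2) :
    ‖binomSum α X - 1‖ < 1 := by
  have hX1 : ‖X‖ < 1 := by linarith
  have hs := summable_norm_binomSum hα hX1
  have h1 : binomSum α X - 1 = ∑' m : ℕ, Ring.choose α (m + 1) • X ^ (m + 1) := by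
    rw [binomSum, hs.of_norm.tsum_eq_zero_add]
    simp
  have hg : Summable fun m : ℕ => ‖X‖ ^ (m + 1) :=
    (summable_nat_add_iff 1).2 (summable_geometric_of_lt_one (norm_nonneg _) hX1)
  rw [h1]
  calc _ ≤ ∑' m : ℕ, ‖X‖ ^ (m + 1) :=
        tsum_of_norm_bounded hg.hasSum fun m => norm_binomSum_term_le hα X (m + 1)
    _ = ‖X‖ * (1 - ‖X‖)⁻¹ := by
        simp only [pow_succ']
        rw [tsum_mul_left, tsum_geometric_of_lt_one (norm_nonneg _) hX1]
    _ < 1 := by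
        rw [← div_eq_mul_inv, div_lt_one (by linarith)]
        linarith

/-- This puts the binomial series of exponent `1 / 2` on the principal branch. -/
theorem re_pos_of_mem_spectrum_of_norm_sub_one_lt {e : A} (he : ‖e - 1‖ < 1) {z : ℂ}
    (hz : z ∈ spectrum ℂ e) : 0 < z.re := by
  have h1 : z - 1 ∈ spectrum ℂ (e - 1) := by
    have := (spectrum.sub_singleton_eq e (1 : ℂ)) ▸
      Set.sub_mem_sub hz (Set.mem_singleton (1 : ℂ))
    simpa using this
  have h2 := (spectrum.norm_le_norm_of_mem h1).trans_lt he
  have h3 := (Complex.abs_re_le_norm (z - 1)).trans_lt h2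
  have h4 := (abs_lt.1 h3).1
  simp at h4
  linarith

end BanachAlgebra

/-! ### Uniqueness of the principal square root -/

/-- Commuting matrices with the same square and spectra in the right half-plane agree: otherwise
`e + f` has a kernel, on which `e` has an eigenvector, for eigenvalues `μ` of `e` and `-μ`
of `f`. -/
theorem eq_of_mul_self_eq_of_commute {n : Type*} [Fintype n] [DecidableEq n] {e f : Matrix n n ℂ}
    (hef : Commute e f) (h : e * e = f * f) (he : ∀ z ∈ spectrum ℂ e, 0 < z.re)
    (hf : ∀ z ∈ spectrum ℂ f, 0 < z.re) : e = f := by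
  set E := Matrix.toLin' e with hE
  set F := Matrix.toLin' f with hF
  have hEF : ∀ v, E (F v) = F (E v) := fun v => by
    rw [hE, hF, ← Matrix.toLin'_mul_apply, ← Matrix.toLin'_mul_apply, hef.eq]
  have hEE : ∀ v, E (E v) = F (F v) := fun v => by
    rw [hE, hF, ← Matrix.toLin'_mul_apply, ← Matrix.toLin'_mul_apply, h]
  suffices hker : LinearMap.ker (E + F) = ⊥ by
    apply Matrix.toLin'.injective
    refine LinearMap.ext fun v => ?_
    have hv : E v - F v ∈ LinearMap.ker (E + F) := by
      rw [LinearMap.mem_ker, LinearMap.add_apply, map_sub, map_sub, hEE, hEF]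
      abel
    rw [hker, Submodule.mem_bot] at hv
    exact sub_eq_zero.1 hv
  by_contra hker
  have : Nontrivial (LinearMap.ker (E + F)) := Submodule.nontrivial_iff_ne_bot.2 hker
  have hmaps : ∀ v ∈ LinearMap.ker (E + F), E v ∈ LinearMap.ker (E + F) := fun v hv => by
    rw [LinearMap.mem_ker, LinearMap.add_apply] at hv ⊢
    rw [← hEF, ← map_add, hv, map_zero]
  obtain ⟨μ, hμ⟩ := Module.End.exists_eigenvalue (E.restrict hmaps)
  obtain ⟨v, hv⟩ := hμ.exists_hasEigenvector
  have hv0 : (v : n → ℂ) ≠ 0 := fun h0 => hv.2 (Subtype.ext h0)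
  have hEv : E v = μ • (v : n → ℂ) := congrArg Subtype.val hv.apply_eq_smul
  have hFv : F v = (-μ) • (v : n → ℂ) := by
    have := v.2
    rw [LinearMap.mem_ker, LinearMap.add_apply, hEv] at this
    rw [neg_smul]
    exact (neg_eq_of_add_eq_zero_right this).symm
  have h1 : μ ∈ spectrum ℂ e := by
    rw [← Matrix.spectrum_toLin', ← Module.End.hasEigenvalue_iff_mem_spectrum]
    exact Module.End.hasEigenvalue_of_hasEigenvector ⟨Module.End.mem_eigenspace_iff.2 hEv, hv0⟩
  have h2 : -μ ∈ spectrum ℂ f := by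
    rw [← Matrix.spectrum_toLin', ← Module.End.hasEigenvalue_iff_mem_spectrum]
    exact Module.End.hasEigenvalue_of_hasEigenvector ⟨Module.End.mem_eigenspace_iff.2 hFv, hv0⟩
  have h3 := he μ h1
  have h4 := hf _ h2
  rw [Complex.neg_re] at h4
  linarith

/-! ### Geometry of a small perturbation of the Minkowski metric -/

section PerturbedMetric

-- any submultiplicative norm will do
attribute [local instance] Matrix.linftyOpNormedRing Matrix.linftyOpNormedAlgebra

theorem eta_mul_eta : eta * eta = 1 := by
  rw [eta, Matrix.diagonal_mul_diagonal, ← Matrix.diagonal_one]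
  congr 1
  funext i
  fin_cases i <;> simp

theorem eta_transpose : eta.transpose = eta := Matrix.diagonal_transpose _

theorem norm_one_half_le : ‖(1 / 2 : ℂ)‖ ≤ 1 := by norm_num

theorem norm_neg_one_half_le : ‖(-1 / 2 : ℂ)‖ ≤ 1 := by norm_num

theorem norm_neg_one_le : ‖(-1 : ℂ)‖ ≤ 1 := by norm_num

theorem hasSum_map_binomSum {V : Type*} [AddCommGroup V] [Module ℂ V] [TopologicalSpace V]
    [IsTopologicalAddGroup V] [ContinuousSMul ℂ V] [T2Space V] {α : ℂ} (hα : ‖α‖ ≤ 1) {X : Mat}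
    (hX : ‖X‖ < 1) (f : Mat →ₗ[ℂ] V) :
    HasSum (fun m : ℕ => Ring.choose α m • f (X ^ m)) (f (binomSum α X)) := by
  simpa only [Function.comp_def, map_smul] using
    (hasSum_binomSum hα hX).map f (LinearMap.continuous_of_finiteDimensional f)

theorem transpose_pow_mul_eta {X : Mat} (hsymm : (eta * X).IsSymm) (m : ℕ) :
    (X ^ m).transpose * eta = eta * X ^ m := by
  have h1 : X.transpose * eta = eta * X := by
    have := hsymm.eq
    rwa [Matrix.transpose_mul, eta_transpose] at this
  induction m with
  | zero => simp
  | succ m ih =>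
    rw [pow_succ', Matrix.transpose_mul, Matrix.mul_assoc, h1, ← Matrix.mul_assoc, ih,
      Matrix.mul_assoc, ← pow_succ, ← pow_succ']

/-- The symmetric gauge condition for the binomial series. -/
theorem transpose_binomSum {α : ℂ} (hα : ‖α‖ ≤ 1) {X : Mat} (hX : ‖X‖ < 1)
    (hsymm : (eta * X).IsSymm) : (binomSum α X).transpose * eta = eta * binomSum α X := by
  let f : Mat →ₗ[ℂ] Mat :=
    (LinearMap.mulRight ℂ eta).comp (Matrix.transposeLinearEquiv (Fin 4) (Fin 4) ℂ ℂ).toLinearMap -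
      LinearMap.mulLeft ℂ eta
  have hf : ∀ M, f M = M.transpose * eta - eta * M := fun M => rfl
  have h := hasSum_map_binomSum hα hX f
  simp only [hf, transpose_pow_mul_eta hsymm, sub_self, smul_zero] at h
  exact sub_eq_zero.1 (h.unique hasSum_zero)

theorem eta_mul_eta_mul (W : Mat) : eta * (eta * W) = W := by
  rw [← Matrix.mul_assoc, eta_mul_eta, Matrix.one_mul]

variable {W : Mat}

theorem isVielbein_binomSum (hW : W.IsSymm) (hX : ‖eta * W‖ < 1 / 2) :
    IsVielbein (eta + W) (binomSum (1 / 2) (eta * W)) := by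
  have hX1 : ‖eta * W‖ < 1 := by linarith
  have hs : (eta * (eta * W)).IsSymm := by rwa [eta_mul_eta_mul]
  have ht := transpose_binomSum norm_one_half_le hX1 hs
  refine ⟨?_, ?_, fun z hz => ?_⟩
  · rw [ht, Matrix.mul_assoc, binomSum_mul norm_one_half_le norm_one_half_le hX1, add_halves,
      binomSum_one, Matrix.mul_add, Matrix.mul_one, eta_mul_eta_mul]
  · rw [Matrix.IsSymm, Matrix.transpose_mul, eta_transpose, ht]
  · exact re_pos_of_mem_spectrum_of_norm_sub_one_lt
      (norm_binomSum_sub_one_lt norm_one_half_le hX) hz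

theorem IsVielbein.mul_self {e : Mat} (h : IsVielbein (eta + W) e) : e * e = 1 + eta * W := by
  have h1 : e.transpose * eta = eta * e := by
    have := h.2.1.eq
    rwa [Matrix.transpose_mul, eta_transpose] at this
  have h2 := h.1
  rw [h1, Matrix.mul_assoc] at h2
  rw [← eta_mul_eta_mul (e * e), h2, Matrix.mul_add, eta_mul_eta]

/-- The symmetric gauge determines the vielbein of a metric close to the Minkowski metric. -/
theorem vielbein_eq (hW : W.IsSymm) (hX : ‖eta * W‖ < 1 / 2) :
    vielbein (eta + W) = binomSum (1 / 2) (eta * W) := by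
  have hP := isVielbein_binomSum hW hX
  have he : IsVielbein (eta + W) (vielbein (eta + W)) := Classical.epsilon_spec ⟨_, hP⟩
  refine eq_of_mul_self_eq_of_commute ?_ (he.mul_self.trans hP.mul_self.symm) he.2.2 hP.2.2
  refine commute_binomSum _ ?_
  have h1 : eta * W = vielbein (eta + W) * vielbein (eta + W) - 1 := by
    rw [he.mul_self]; abel
  rw [h1]
  exact ((Commute.refl _).mul_right (Commute.refl _)).sub_right (Commute.one_right _)

theorem inv_vielbein_eq (hW : W.IsSymm) (hX : ‖eta * W‖ < 1 / 2) :
    (vielbein (eta + W))⁻¹ = binomSum (-1 / 2) (eta * W) := by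
  rw [vielbein_eq hW hX]
  refine Matrix.inv_eq_left_inv ?_
  rw [binomSum_mul norm_neg_one_half_le norm_one_half_le (by linarith),
    show (-1 / 2 + 1 / 2 : ℂ) = 0 by norm_num, binomSum_zero]

theorem inv_metric_eq (hX : ‖eta * W‖ < 1 / 2) :
    (eta + W)⁻¹ = binomSum (-1) (eta * W) * eta := by
  refine Matrix.inv_eq_left_inv ?_
  rw [Matrix.mul_assoc, Matrix.mul_add, eta_mul_eta, ← binomSum_one,
    binomSum_mul norm_neg_one_le (by simp) (by linarith), neg_add_cancel, binomSum_zero]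

/-- In the symmetric gauge, lowering the curved index of the inverse metric to a flat one gives
the inverse vielbein: `e_τ^t g^{τλ} = e^{λt}`. -/
theorem vielbein_mul_inv_metric (hW : W.IsSymm) (hX : ‖eta * W‖ < 1 / 2) (t l : Fin 4) :
    ∑ τ, vielbein (eta + W) t τ * (eta + W)⁻¹ τ l = invVielbein (eta + W) l t := by
  have hX1 : ‖eta * W‖ < 1 := by linarith
  have hs : (eta * (eta * W)).IsSymm := by rwa [eta_mul_eta_mul]
  have h1 : vielbein (eta + W) * (eta + W)⁻¹ = binomSum (-1 / 2) (eta * W) * eta := by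
    rw [vielbein_eq hW hX, inv_metric_eq hX, ← Matrix.mul_assoc,
      binomSum_mul norm_one_half_le norm_neg_one_le hX1]
    norm_num
  have h2 : (binomSum (-1 / 2) (eta * W) * eta).transpose = binomSum (-1 / 2) (eta * W) * eta := by
    have := transpose_binomSum norm_neg_one_half_le hX1 hs
    rw [Matrix.transpose_mul, eta_transpose]
    calc eta * (binomSum (-1 / 2) (eta * W)).transpose
        = eta * ((binomSum (-1 / 2) (eta * W)).transpose * eta) * eta := by
          rw [Matrix.mul_assoc, Matrix.mul_assoc, eta_mul_eta, Matrix.mul_one]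
      _ = _ := by rw [this, eta_mul_eta_mul]
  rw [← Matrix.mul_apply, h1, invVielbein, inv_vielbein_eq hW hX]
  exact congrFun (congrFun h2 l) t

end PerturbedMetric

/-! ### Words of legs and matrix products -/

theorem chain_dependsOnFirst (m : ℕ) (μ ν : Fin 4) : DependsOnFirst m (chain m μ ν) := by
  intro a b h
  refine prod_congr rfl fun i hi => ?_
  have hi' := mem_range.1 hi
  have h1 : (if i = 0 then μ else (a (i - 1)).μ) = if i = 0 then μ else (b (i - 1)).μ := by
    split_ifs with h0
    · rfl
    · rw [h _ (by omega)]
  have h2 : (if i = m then ν else (a i).ν) = if i = m then ν else (b i).ν := by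
    split_ifs with h0
    · rfl
    · rw [h _ (by omega)]
  rw [h1, h2]

theorem chain_zero (μ ν : Fin 4) (a : ℕ → Leg) : chain 0 μ ν a = eta μ ν := by
  simp [chain]

theorem chain_succ (m : ℕ) (μ ν : Fin 4) (a : ℕ → Leg) :
    chain (m + 1) μ ν a = eta μ (a 0).ν * chain m (a 0).μ ν (shift 1 a) := by
  rw [chain, prod_range_succ', chain, mul_comm]
  congr 1
  refine prod_congr rfl fun i _ => ?_
  simp only [shift, Nat.add_sub_cancel, Nat.succ_ne_zero, if_false, Nat.add_right_cancel_iff,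
    Nat.add_comm 1]
  congr 1
  by_cases h : i = 0
  · subst h; simp
  · rw [if_neg h, Nat.sub_add_cancel (Nat.pos_of_ne_zero h)]

theorem sum_mul_delta (f : Fin 4 → ℂ) (ν : Fin 4) : ∑ μ, f μ * delta μ ν = f ν := by
  simp [delta]

section

variable {K : Type*} [Fintype K] (wt : K → ℂ) (ℓ : K → Leg)

/-- The constant graviton field `∑ k, wt k • E_{ν_k μ_k}`, with `E` the matrix units. -/
def legMat : Mat := Matrix.of fun ρ σ => ∑ k, wt k * (delta ρ (ℓ k).ν * delta σ (ℓ k).μ)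

theorem legMat_apply (ρ σ : Fin 4) :
    legMat wt ℓ ρ σ = ∑ k, wt k * (delta ρ (ℓ k).ν * delta σ (ℓ k).μ) := rfl

theorem eta_mul_legMat_apply (μ β : Fin 4) :
    (eta * legMat wt ℓ) μ β = ∑ k, wt k * (eta μ (ℓ k).ν * delta β (ℓ k).μ) := by
  simp only [Matrix.mul_apply, legMat_apply, mul_sum]
  rw [sum_comm]
  refine sum_congr rfl fun k _ => ?_
  rw [← sum_mul_delta (fun α => eta μ α) (ℓ k).ν, sum_mul, mul_sum]
  exact sum_congr rfl fun α _ => by ring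

theorem dependsOnFirst_one (φ : Leg → ℂ) : DependsOnFirst 1 fun a => φ (a 0) :=
  fun _ _ h => congrArg φ (h 0 Nat.one_pos)

theorem legSum_chain (m : ℕ) (μ ν : Fin 4) :
    legSum wt ℓ m (chain m μ ν) = ((eta * legMat wt ℓ) ^ m * eta) μ ν := by
  induction m generalizing μ with
  | zero =>
    rw [legSum_zero, chain_zero, pow_zero, Matrix.one_mul]
  | succ m ih =>
    have h : ∀ a, chain (m + 1) μ ν a = ∑ β, (eta μ (a 0).ν * delta β (a 0).μ) *
        chain m β ν (shift 1 a) := fun a => by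
      rw [chain_succ, ← sum_mul_delta (fun β => chain m β ν (shift 1 a)), mul_sum]
      exact sum_congr rfl fun β _ => by ring
    rw [legSum_congr wt ℓ h, legSum_sum, pow_succ', Matrix.mul_assoc, Matrix.mul_apply]
    refine sum_congr rfl fun β _ => ?_
    rw [add_comm m 1, legSum_mul_shift wt ℓ m
      (dependsOnFirst_one fun a => eta μ a.ν * delta β a.μ), ih,
      legSum_one wt ℓ fun a => eta μ a.ν * delta β a.μ, eta_mul_legMat_apply]

/-! ### Products of traces -/

/-- `N` copies of a rule for `d` gravitons, the `i`-th copy acting on the gravitons number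
`i, i + N, …, i + (d - 1) N`. -/
theorem legSum_prod_stride (d N : ℕ) {ψ : (ℕ → Leg) → ℂ} (hψ : DependsOnFirst d ψ) :
    legSum wt ℓ (d * N) (fun a => ∏ i ∈ range N, ψ fun e => a (i + N * e)) =
      legSum wt ℓ d ψ ^ N := by
  have h1 : legSum wt ℓ d ψ ^ N = ∏ _i : Fin N, legSum wt ℓ d ψ := by simp
  rw [h1]
  simp only [legSum]
  rw [Finset.prod_univ_sum, Fintype.piFinset_univ]
  let e : (Fin N → Fin d → K) ≃ (Fin (d * N) → K) :=
    (Equiv.curry (Fin N) (Fin d) K).symm.trans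
      (Equiv.arrowCongr ((Equiv.prodComm _ _).trans finProdFinEquiv) (Equiv.refl K))
  have he : ∀ (g : Fin N → Fin d → K) (i : Fin N) (j : Fin d),
      e g (finProdFinEquiv (j, i)) = g i j := fun g i j => by simp [e]
  rw [← e.sum_comp]
  refine sum_congr rfl fun g _ => ?_
  rw [prod_mul_distrib]
  congr 1
  · rw [← (finProdFinEquiv (m := d) (n := N)).prod_comp, Fintype.prod_prod_type, Finset.prod_comm]
    simp only [he]
  · rw [← Fin.prod_univ_eq_prod_range fun i =>
      ψ fun j => toSeq (fun i => ℓ (e g i)) (i + N * j)]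
    refine prod_congr rfl fun i _ => hψ _ _ fun j hj => ?_
    have hlt := (finProdFinEquiv (m := d) (n := N) (⟨j, hj⟩, i)).2
    rw [finProdFinEquiv_apply_val] at hlt
    have hlt' : (i : ℕ) + N * j < d * N := hlt
    simp only [toSeq, hlt', hj, dif_pos]
    rw [← he g i ⟨j, hj⟩]
    rfl

theorem dependsOnFirst_prod_stride {d : ℕ} (N : ℕ) {ψ : (ℕ → Leg) → ℂ}
    (hψ : DependsOnFirst d ψ) :
    DependsOnFirst (d * N) fun a => ∏ i ∈ range N, ψ fun e => a (i + N * e) := by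
  intro a b h
  refine prod_congr rfl fun i hi => hψ _ _ fun e he => h _ ?_
  have hi' := mem_range.1 hi
  calc i + N * e < N + N * e := by omega
    _ = (e + 1) * N := by ring
    _ ≤ d * N := Nat.mul_le_mul_right N he

/-- The cyclic product of `d + 1` gravitons, each contracted with its successor. -/
def cycle (d : ℕ) (a : ℕ → Leg) : ℂ := chain d (a 0).μ (a 0).ν (shift 1 a)

/-- The product of two gravitons with `μ` contracted with `μ` and `ν` with `ν`. -/
def pairing (a : ℕ → Leg) : ℂ := eta (a 0).μ (a 1).μ * eta (a 0).ν (a 1).ν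

theorem cycle_dependsOnFirst (d : ℕ) : DependsOnFirst (d + 1) (cycle d) := by
  intro a b h
  rw [cycle, cycle, h 0 (Nat.succ_pos d)]
  exact chain_dependsOnFirst d _ _ _ _ fun i hi => h (1 + i) (by omega)

theorem pairing_dependsOnFirst : DependsOnFirst 2 pairing := by
  intro a b h
  rw [pairing, pairing, h 0 (by norm_num), h 1 (by norm_num)]

/-- The cyclic product of `d + 1` gravitons has the value `tr ((η W) ^ (d + 1))`. -/
theorem legSum_cycle (d : ℕ) :
    legSum wt ℓ (d + 1) (cycle d) =
      ((eta * legMat wt ℓ) ^ (d + 1)).trace := by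
  have h : ∀ a : ℕ → Leg, cycle d a = ∑ β, ∑ α,
      (delta β (a 0).ν * delta α (a 0).μ) * chain d α β (shift 1 a) := fun a => by
    rw [cycle, ← sum_mul_delta (fun β => chain d (a 0).μ β (shift 1 a))]
    refine sum_congr rfl fun β _ => ?_
    rw [← sum_mul_delta (fun α => chain d α β (shift 1 a)), sum_mul]
    exact sum_congr rfl fun α _ => by ring
  rw [legSum_congr wt ℓ h, legSum_sum, pow_succ, ← Matrix.mul_assoc, Matrix.trace_mul_comm,
    Matrix.trace]
  refine sum_congr rfl fun β _ => ?_
  rw [legSum_sum, Matrix.diag_apply, Matrix.mul_apply]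
  refine sum_congr rfl fun α _ => ?_
  rw [add_comm d 1, legSum_mul_shift wt ℓ d
      (dependsOnFirst_one fun a => delta β a.ν * delta α a.μ), legSum_chain,
      legSum_one wt ℓ fun a => delta β a.ν * delta α a.μ, legMat_apply]

/-- The product of two gravitons in `𝔳` contracts `μ` with `μ` and `ν` with `ν`; for a symmetric
field this is the trace of the square. -/
theorem legSum_pair (hW : (legMat wt ℓ).IsSymm) :
    legSum wt ℓ 2 pairing =
      ((eta * legMat wt ℓ) ^ 2).trace := by
  have h : ∀ a : ℕ → Leg, pairing a = ∑ β, ∑ α,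
      (delta β (a 0).ν * delta α (a 0).μ) *
        (fun b : ℕ → Leg => eta α (b 0).μ * eta β (b 0).ν) (shift 1 a) := fun a => by
    rw [pairing, ← sum_mul_delta (fun β => eta β (a 1).ν), mul_sum]
    refine sum_congr rfl fun β _ => ?_
    rw [← sum_mul_delta (fun α => eta α (a 1).μ), sum_mul]
    exact sum_congr rfl fun α _ => by simp only [shift]; ring
  have h2 : ∀ α β, ∑ k, wt k * (eta α (ℓ k).μ * eta β (ℓ k).ν) =
      (eta * legMat wt ℓ * eta) β α := fun α β => by
    rw [Matrix.mul_apply]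
    simp only [eta_mul_legMat_apply, sum_mul]
    rw [sum_comm]
    refine sum_congr rfl fun k _ => ?_
    have h3 : eta α (ℓ k).μ = ∑ γ, eta γ α * delta γ (ℓ k).μ := by
      rw [sum_mul_delta (fun γ => eta γ α)]
      exact congrFun (congrFun eta_transpose.symm _) _
    rw [h3, sum_mul, mul_sum]
    exact sum_congr rfl fun γ _ => by ring
  have hs : ∀ α β, legMat wt ℓ α β = legMat wt ℓ β α := fun α β => hW.apply β α
  rw [legSum_congr wt ℓ h, legSum_sum, pow_two, ← Matrix.mul_assoc, Matrix.trace]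
  simp only [legSum_sum, Matrix.diag_apply, Matrix.mul_apply (M := eta * legMat wt ℓ * eta)]
  refine sum_congr rfl fun β _ => sum_congr rfl fun α _ => ?_
  rw [show 2 = 1 + 1 from rfl, legSum_mul_shift wt ℓ 1
      (dependsOnFirst_one fun a => delta β a.ν * delta α a.μ)
      (fun a => eta α (a 0).μ * eta β (a 0).ν),
      legSum_one wt ℓ fun a => eta α a.μ * eta β a.ν,
      legSum_one wt ℓ fun a => delta β a.ν * delta α a.μ, ← legMat_apply, h2, hs, mul_comm]

theorem traces_eq (A B C D : ℕ) (a : ℕ → Leg) :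
    traces A B C D a =
      (∏ i ∈ range A, cycle 0 fun e => a (i + A * e)) *
      (fun b : ℕ → Leg => (∏ i ∈ range B, pairing fun e => b (i + B * e)) *
        (fun b : ℕ → Leg => (∏ i ∈ range C, cycle 2 fun e => b (i + C * e)) *
          (fun b : ℕ → Leg => ∏ i ∈ range D, cycle 3 fun e => b (i + D * e))
            (shift (3 * C) b)) (shift (2 * B) b)) (shift (1 * A) a) := by
  simp only [traces, cycle, pairing, chain_succ, chain_zero, shift, mul_assoc, Nat.add_assoc,
    Nat.mul_zero, Nat.mul_one, Nat.add_zero, Nat.one_mul, Nat.reduceAdd, Nat.mul_comm _ 2,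
    Nat.mul_comm _ 3]

theorem legSum_traces (hW : (legMat wt ℓ).IsSymm) (A B C D : ℕ) :
    legSum wt ℓ (A + 2 * B + 3 * C + 4 * D) (traces A B C D) =
      (eta * legMat wt ℓ).trace ^ A * ((eta * legMat wt ℓ) ^ 2).trace ^ B *
      ((eta * legMat wt ℓ) ^ 3).trace ^ C * ((eta * legMat wt ℓ) ^ 4).trace ^ D := by
  have d0 : DependsOnFirst 1 (cycle 0) := cycle_dependsOnFirst 0
  have d2 : DependsOnFirst 3 (cycle 2) := cycle_dependsOnFirst 2
  have d3 : DependsOnFirst 4 (cycle 3) := cycle_dependsOnFirst 3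
  have t0 := legSum_cycle wt ℓ 0
  have t2 := legSum_cycle wt ℓ 2
  have t3 := legSum_cycle wt ℓ 3
  simp only [Nat.zero_add, Nat.reduceAdd, pow_one] at t0 t2 t3
  rw [legSum_congr wt ℓ (traces_eq A B C D),
    show A + 2 * B + 3 * C + 4 * D = 1 * A + (2 * B + (3 * C + 4 * D)) by ring,
    legSum_mul_shift wt ℓ _ (dependsOnFirst_prod_stride A d0) (fun b : ℕ → Leg =>
      (∏ i ∈ range B, pairing fun e => b (i + B * e)) *
        (fun b : ℕ → Leg => (∏ i ∈ range C, cycle 2 fun e => b (i + C * e)) *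
          (fun b : ℕ → Leg => ∏ i ∈ range D, cycle 3 fun e => b (i + D * e))
            (shift (3 * C) b)) (shift (2 * B) b)),
    legSum_mul_shift wt ℓ _ (dependsOnFirst_prod_stride B pairing_dependsOnFirst)
      (fun b : ℕ → Leg => (∏ i ∈ range C, cycle 2 fun e => b (i + C * e)) *
        (fun b : ℕ → Leg => ∏ i ∈ range D, cycle 3 fun e => b (i + D * e)) (shift (3 * C) b)),
    legSum_mul_shift wt ℓ _ (dependsOnFirst_prod_stride C d2)
      (fun b : ℕ → Leg => ∏ i ∈ range D, cycle 3 fun e => b (i + D * e)),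
    legSum_prod_stride wt ℓ _ A d0, legSum_prod_stride wt ℓ _ B pairing_dependsOnFirst,
    legSum_prod_stride wt ℓ _ C d2, legSum_prod_stride wt ℓ _ D d3,
    t0, t2, t3, legSum_pair wt ℓ hW]
  ring

end

/-! ### The volume density -/

set_option maxHeartbeats 2000000 in
/-- The expansion of the determinant in elementary symmetric functions of the eigenvalues, written
by Newton's identities in terms of the traces of powers. -/
theorem det_one_add_smul (X : Mat) (z : ℂ) :
    (1 + z • X).det = 1 + (z * X.trace + (z ^ 2 * ((X.trace ^ 2 - (X ^ 2).trace) / 2) +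
      (z ^ 3 * ((X.trace ^ 3 - 3 * X.trace * (X ^ 2).trace + 2 * (X ^ 3).trace) / 6) +
      z ^ 4 * ((X.trace ^ 4 - 6 * X.trace ^ 2 * (X ^ 2).trace + 3 * (X ^ 2).trace ^ 2 +
        8 * X.trace * (X ^ 3).trace - 6 * (X ^ 4).trace) / 24)))) := by
  simp only [Matrix.trace, Matrix.diag_apply, pow_succ, pow_zero, Matrix.one_mul, Matrix.mul_apply,
    Fin.sum_univ_four, Matrix.det_succ_row_zero (n := 3), Matrix.det_fin_three,
    Matrix.submatrix_apply, Matrix.add_apply, Matrix.smul_apply, smul_eq_mul, Matrix.one_apply,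
    Fin.succAbove]
  simp
  ring

theorem det_eta : eta.det = -1 := by
  rw [eta, Matrix.det_diagonal]
  simp [Fin.prod_univ_four]

theorem neg_det_metric (W : Mat) (z : ℂ) : -(eta + z • W).det = (1 + z • (eta * W)).det := by
  have h : eta + z • W = eta * (1 + z • (eta * W)) := by
    rw [Matrix.mul_add, Matrix.mul_one, Matrix.mul_smul, eta_mul_eta_mul]
  rw [h, Matrix.det_mul, det_eta]
  ring

theorem hasTaylor_sqrt_one_add :
    HasTaylor (fun w : ℂ => (1 + w) ^ (1 / 2 : ℂ)) (PowerSeries.mk binomHalf) := by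
  rw [hasTaylor_iff]
  simp only [PowerSeries.coeff_mk]
  exact (Complex.one_add_cpow_hasFPowerSeriesOnBall_zero (a := 1 / 2)).hasFPowerSeriesAt

/-- The multinomial expansion of the powers of a polynomial of degree four without constant
term. -/
theorem coeff_pow_quartic (c₁ c₂ c₃ c₄ : ℂ) (i m : ℕ) :
    PowerSeries.coeff m ((PowerSeries.X * PowerSeries.C c₁ + (PowerSeries.X ^ 2 * PowerSeries.C c₂ +
      (PowerSeries.X ^ 3 * PowerSeries.C c₃ + PowerSeries.X ^ 4 * PowerSeries.C c₄))) ^ i) =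
    ∑ j ∈ range (i + 1), ∑ k ∈ range (j + 1), ∑ l ∈ range (k + 1),
      if i + j + k + l = m then ((i.choose j * j.choose k * k.choose l : ℕ) : ℂ) *
        (c₁ ^ (i - j) * (c₂ ^ (j - k) * (c₃ ^ (k - l) * c₄ ^ l))) else 0 := by
  rw [add_comm (PowerSeries.X * _), add_pow, map_sum]
  refine sum_congr rfl fun j hj => ?_
  rw [add_comm (PowerSeries.X ^ 2 * _), add_pow, sum_mul, sum_mul, map_sum]
  refine sum_congr rfl fun k hk => ?_
  rw [add_comm (PowerSeries.X ^ 3 * _), add_pow, sum_mul, sum_mul, sum_mul, sum_mul, map_sum]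
  refine sum_congr rfl fun l hl => ?_
  obtain ⟨k', rfl⟩ := Nat.exists_eq_add_of_le (Nat.lt_succ_iff.1 (mem_range.1 hl))
  obtain ⟨j', rfl⟩ := Nat.exists_eq_add_of_le (Nat.lt_succ_iff.1 (mem_range.1 hk))
  obtain ⟨i', rfl⟩ := Nat.exists_eq_add_of_le (Nat.lt_succ_iff.1 (mem_range.1 hj))
  simp only [Nat.add_sub_cancel_left]
  rw [← map_natCast (PowerSeries.C (R := ℂ)), ← map_natCast (PowerSeries.C (R := ℂ)),
    ← map_natCast (PowerSeries.C (R := ℂ))]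
  -- collect the power of `X`: the exponent is `i + j + k + l`
  have h : ∀ a b c : ℂ, (PowerSeries.X ^ 4 * PowerSeries.C c₄) ^ l *
      (PowerSeries.X ^ 3 * PowerSeries.C c₃) ^ k' * PowerSeries.C a *
      (PowerSeries.X ^ 2 * PowerSeries.C c₂) ^ j' * PowerSeries.C b *
      (PowerSeries.X * PowerSeries.C c₁) ^ i' * PowerSeries.C c =
      PowerSeries.C (c * b * a * (c₁ ^ i' * (c₂ ^ j' * (c₃ ^ k' * c₄ ^ l)))) *
        PowerSeries.X ^ (l + k' + j' + i' + (l + k' + j') + (l + k') + l) := fun a b c => by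
    simp only [map_mul, map_pow]
    ring
  rw [h, PowerSeries.coeff_C_mul_X_pow]
  push_cast
  simp only [eq_comm (a := m)]

section

variable (a b w t₁ t₂ t₃ t₄ : ℂ)

/-- Powers of the second elementary symmetric function, expanded in the traces `t₁` and `t₂`. Here
and in the next two lemmas `a`, `b`, `w` stand for `1 / 2`, `1 / 3`, `-1`. -/
theorem e_two_pow (n : ℕ) : (t₁ ^ 2 * a + w * t₂ * a) ^ n = ∑ p ∈ range (n + 1),
    (n.choose p : ℂ) * ((w * t₂ * a) ^ p * (t₁ ^ 2 * a) ^ (n - p)) := by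
  rw [add_comm, add_pow]
  exact sum_congr rfl fun p _ => by ring

theorem e_three_pow (n : ℕ) :
    (t₁ ^ 3 * (a * b) + (w * (t₁ * t₂) * a + t₃ * b)) ^ n =
      ∑ q ∈ range (n + 1), ∑ r ∈ range (q + 1), (n.choose q * q.choose r : ℂ) *
        ((t₃ * b) ^ r * (w * (t₁ * t₂) * a) ^ (q - r) * (t₁ ^ 3 * (a * b)) ^ (n - q)) := by
  rw [add_comm, add_pow]
  refine sum_congr rfl fun q _ => ?_
  rw [add_comm, add_pow, sum_mul, sum_mul]
  exact sum_congr rfl fun r _ => by ring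

theorem e_four_pow (n : ℕ) :
    (t₁ ^ 4 * (a ^ 3 * b) + (w * (t₁ ^ 2 * t₂) * a ^ 2 + (t₁ * t₃ * b +
      (t₂ ^ 2 * a ^ 3 + w * t₄ * a ^ 2)))) ^ n =
      ∑ s ∈ range (n + 1), ∑ t ∈ range (s + 1), ∑ u ∈ range (t + 1), ∑ v ∈ range (u + 1),
        (n.choose s * s.choose t * t.choose u * u.choose v : ℂ) *
        ((w * t₄ * a ^ 2) ^ v * (t₂ ^ 2 * a ^ 3) ^ (u - v) * (t₁ * t₃ * b) ^ (t - u) *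
          (w * (t₁ ^ 2 * t₂) * a ^ 2) ^ (s - t) * (t₁ ^ 4 * (a ^ 3 * b)) ^ (n - s)) := by
  rw [add_comm, add_pow]
  refine sum_congr rfl fun s _ => ?_
  rw [add_comm, add_pow, sum_mul, sum_mul]
  refine sum_congr rfl fun t _ => ?_
  rw [add_comm, add_pow, sum_mul, sum_mul, sum_mul, sum_mul]
  refine sum_congr rfl fun u _ => ?_
  rw [add_comm, add_pow, sum_mul, sum_mul, sum_mul, sum_mul, sum_mul, sum_mul]
  exact sum_congr rfl fun v _ => by ring

end

section

variable {K : Type*} [Fintype K] (wt : K → ℂ) (ℓ : K → Leg)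

theorem legSum_ite_zero (m : ℕ) (P : Prop) [Decidable P] (Φ : (ℕ → Leg) → ℂ) :
    legSum wt ℓ m (fun a => if P then Φ a else 0) = if P then legSum wt ℓ m Φ else 0 := by
  split_ifs
  · rfl
  · simp [legSum]

/-- The rule `𝔳_m` evaluates to the part of degree `m` of `∑ i, binom(1/2, i) u ^ i`, where
`u = e₁ + e₂ + e₃ + e₄` is the sum of the elementary symmetric functions of the eigenvalues of the
perturbation. -/
theorem legSum_vRule (hW : (legMat wt ℓ).IsSymm) (ϰ : ℝ) (m : ℕ) :
    legSum wt ℓ m (vRule ϰ m) = (ϰ : ℂ) ^ m * ∑ i ∈ range (m + 1), binomHalf i *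
      ∑ j ∈ range (i + 1), ∑ k ∈ range (j + 1), ∑ l ∈ range (k + 1),
      if i + j + k + l = m then ((i.choose j * j.choose k * k.choose l : ℕ) : ℂ) *
        ((eta * legMat wt ℓ).trace ^ (i - j) *
        ((((eta * legMat wt ℓ).trace ^ 2 - ((eta * legMat wt ℓ) ^ 2).trace) / 2) ^ (j - k) *
        ((((eta * legMat wt ℓ).trace ^ 3 -
            3 * (eta * legMat wt ℓ).trace * ((eta * legMat wt ℓ) ^ 2).trace +
            2 * ((eta * legMat wt ℓ) ^ 3).trace) / 6) ^ (k - l) *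
         (((eta * legMat wt ℓ).trace ^ 4 -
            6 * (eta * legMat wt ℓ).trace ^ 2 * ((eta * legMat wt ℓ) ^ 2).trace +
            3 * ((eta * legMat wt ℓ) ^ 2).trace ^ 2 +
            8 * (eta * legMat wt ℓ).trace * ((eta * legMat wt ℓ) ^ 3).trace -
            6 * ((eta * legMat wt ℓ) ^ 4).trace) / 24) ^ l))) else 0 := by
  have htr := legSum_traces wt ℓ hW
  set t₁ := (eta * legMat wt ℓ).trace
  set t₂ := ((eta * legMat wt ℓ) ^ 2).trace
  set t₃ := ((eta * legMat wt ℓ) ^ 3).trace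
  set t₄ := ((eta * legMat wt ℓ) ^ 4).trace
  unfold vRule
  rw [legSum_const_mul]
  congr 1
  rw [legSum_sum]
  refine sum_congr rfl fun i _ => ?_
  rw [legSum_sum, mul_sum]
  refine sum_congr rfl fun j hj => ?_
  rw [legSum_sum, mul_sum]
  refine sum_congr rfl fun k hk => ?_
  rw [legSum_sum, mul_sum]
  refine sum_congr rfl fun l hl => ?_
  rw [legSum_ite_zero]
  split_ifs with hm
  swap
  · rw [mul_zero]
  have e2 : (t₁ ^ 2 - t₂) / 2 = t₁ ^ 2 * 2⁻¹ + (-1) * t₂ * 2⁻¹ := by ring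
  have e3 : (t₁ ^ 3 - 3 * t₁ * t₂ + 2 * t₃) / 6 =
      t₁ ^ 3 * (2⁻¹ * 3⁻¹) + ((-1) * (t₁ * t₂) * 2⁻¹ + t₃ * 3⁻¹) := by ring
  have e4 : (t₁ ^ 4 - 6 * t₁ ^ 2 * t₂ + 3 * t₂ ^ 2 + 8 * t₁ * t₃ - 6 * t₄) / 24 =
      t₁ ^ 4 * (2⁻¹ ^ 3 * 3⁻¹) + ((-1) * (t₁ ^ 2 * t₂) * 2⁻¹ ^ 2 + (t₁ * t₃ * 3⁻¹ +
      (t₂ ^ 2 * 2⁻¹ ^ 3 + (-1) * t₄ * 2⁻¹ ^ 2))) := by ring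
  rw [e2, e3, e4, e_two_pow, e_three_pow, e_four_pow]
  rw [legSum_sum, sum_mul, mul_sum, mul_sum, mul_sum]
  refine sum_congr rfl fun p hp => ?_
  rw [legSum_sum, sum_mul, mul_sum, mul_sum, mul_sum, mul_sum]
  refine sum_congr rfl fun q hq => ?_
  rw [legSum_sum, sum_mul, mul_sum, mul_sum, mul_sum, mul_sum]
  refine sum_congr rfl fun r hr => ?_
  rw [legSum_sum, mul_sum, mul_sum, mul_sum, mul_sum, mul_sum]
  refine sum_congr rfl fun s hs => ?_
  rw [legSum_sum, mul_sum, mul_sum, mul_sum, mul_sum, mul_sum]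
  refine sum_congr rfl fun t ht => ?_
  rw [legSum_sum, mul_sum, mul_sum, mul_sum, mul_sum, mul_sum]
  refine sum_congr rfl fun u hu => ?_
  rw [legSum_sum, mul_sum, mul_sum, mul_sum, mul_sum, mul_sum]
  refine sum_congr rfl fun v hv => ?_
  rw [legSum_const_mul]
  simp only [mem_range, Nat.lt_succ_iff] at hj hk hl hp hq hr hs ht hu hv
  -- replace the outer summation indices by differences, so that no truncated subtraction is left
  obtain ⟨v', rfl⟩ := Nat.exists_eq_add_of_le hv
  obtain ⟨u', rfl⟩ := Nat.exists_eq_add_of_le hu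
  obtain ⟨t', rfl⟩ := Nat.exists_eq_add_of_le ht
  obtain ⟨s', rfl⟩ := Nat.exists_eq_add_of_le hs
  obtain ⟨r', rfl⟩ := Nat.exists_eq_add_of_le hr
  obtain ⟨k', rfl⟩ := Nat.exists_eq_add_of_le hl
  obtain ⟨j', rfl⟩ := Nat.exists_eq_add_of_le hk
  obtain ⟨i', rfl⟩ := Nat.exists_eq_add_of_le hj
  simp only [Nat.add_sub_cancel_left] at hp hq ⊢
  obtain ⟨q', rfl⟩ := Nat.exists_eq_add_of_le hq
  obtain ⟨p', rfl⟩ := Nat.exists_eq_add_of_le hp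
  simp only [Nat.add_sub_cancel_left]
  -- the number of single traces; here the truncated subtraction is seen to be exact
  have hA : ∀ M N : ℕ, M = N + (i' + 2 * p' + 3 * q' + r' + 4 * s' + 2 * t' + u') →
      M - N = i' + 2 * p' + 3 * q' + r' + 4 * s' + 2 * t' + u' := fun M N h => by omega
  rw [hA _ _ (by ring)]
  have hm' : m = (i' + 2 * p' + 3 * q' + r' + 4 * s' + 2 * t' + u') + 2 * (p + r' + t' + 2 * v') +
      3 * (r + u') + 4 * v := by rw [← hm]; ring
  rw [hm', htr]
  have h2 : ∀ e : ℤ, e = -((3 * s' + 2 * t' + 3 * v' + 2 * v + r' + q' + p + p' : ℕ) : ℤ) →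
      (2 : ℂ) ^ e = 2⁻¹ ^ (3 * s' + 2 * t' + 3 * v' + 2 * v + r' + q' + p + p') := fun e he => by
    rw [he, zpow_neg, zpow_natCast, inv_pow]
  have h3 : ∀ e : ℤ, e = -((s' + q' + r + u' : ℕ) : ℤ) →
      (3 : ℂ) ^ e = 3⁻¹ ^ (s' + q' + r + u') := fun e he => by
    rw [he, zpow_neg, zpow_natCast, inv_pow]
  rw [h2 _ (by push_cast; ring), h3 _ (by push_cast; ring)]
  push_cast
  generalize (2⁻¹ : ℂ) = a
  generalize (3⁻¹ : ℂ) = b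
  generalize (-1 : ℂ) = w
  ring

end

section Blocks

attribute [local instance] Matrix.linftyOpNormedRing Matrix.linftyOpNormedAlgebra

/-! ### Expansions at a constant field -/

theorem eventually_norm_eta_mul_smul_lt (W : Mat) {r : ℝ} (hr : 0 < r) :
    ∀ᶠ z in 𝓝 (0 : ℂ), ‖eta * (z • W)‖ < r := by
  have h : Tendsto (fun z : ℂ => ‖z‖ * ‖eta * W‖) (𝓝 0) (𝓝 0) := by
    have : Continuous fun z : ℂ => ‖z‖ * ‖eta * W‖ := by fun_prop
    simpa using this.tendsto 0
  filter_upwards [h.eventually_lt_const hr] with z hz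
  rwa [Matrix.mul_smul, norm_smul]

section

variable {K : Type*} [Fintype K] {wt : K → ℂ} {ℓ : K → Leg}

theorem hasExpansion_volDensity (hW : (legMat wt ℓ).IsSymm) (ϰ : ℝ) :
    HasExpansion wt ℓ ϰ (fun z => volDensity (eta + z • legMat wt ℓ)) (vRule ϰ) := by
  set X := eta * legMat wt ℓ with hX
  set e₂ := (X.trace ^ 2 - (X ^ 2).trace) / 2 with he₂
  set e₃ := (X.trace ^ 3 - 3 * X.trace * (X ^ 2).trace + 2 * (X ^ 3).trace) / 6 with he₃
  set e₄ := (X.trace ^ 4 - 6 * X.trace ^ 2 * (X ^ 2).trace + 3 * (X ^ 2).trace ^ 2 +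
        8 * X.trace * (X ^ 3).trace - 6 * (X ^ 4).trace) / 24 with he₄
  have hu := (hasTaylor_id.mul (hasTaylor_const X.trace)).add
    (((hasTaylor_id.pow 2).mul (hasTaylor_const e₂)).add
      (((hasTaylor_id.pow 3).mul (hasTaylor_const e₃)).add
        ((hasTaylor_id.pow 4).mul (hasTaylor_const e₄))))
  have hdvd : PowerSeries.X ∣ (PowerSeries.X * PowerSeries.C X.trace +
      (PowerSeries.X ^ 2 * PowerSeries.C e₂ + (PowerSeries.X ^ 3 * PowerSeries.C e₃ +
        PowerSeries.X ^ 4 * PowerSeries.C e₄)) : PowerSeries ℂ) :=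
    ⟨PowerSeries.C X.trace + (PowerSeries.X * PowerSeries.C e₂ +
      (PowerSeries.X ^ 2 * PowerSeries.C e₃ + PowerSeries.X ^ 3 * PowerSeries.C e₄)), by ring⟩
  refine ⟨_, (hasTaylor_sqrt_one_add.comp hu hdvd).congr (Eventually.of_forall fun z => ?_),
    fun n => ?_⟩
  · rw [volDensity, neg_det_metric, det_one_add_smul]
  · rw [PowerSeries.coeff_mk, legSum_vRule wt ℓ hW]
    simp only [PowerSeries.coeff_mk, coeff_pow_quartic, ← hX, ← he₂, ← he₃, ← he₄]

theorem mul_eta_apply_linear (μ ν : Fin 4) :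
    ∃ f : Mat →ₗ[ℂ] ℂ, ∀ M, f M = (M * eta) μ ν :=
  ⟨(Matrix.entryLinearMap ℂ ℂ μ ν).comp (LinearMap.mulRight ℂ eta), fun _ => rfl⟩

theorem hasSum_binomSum_mul_eta {α : ℂ} (hα : ‖α‖ ≤ 1) {z : ℂ}
    (hz : ‖eta * (z • legMat wt ℓ)‖ < 1) (μ ν : Fin 4) :
    HasSum (fun m => Ring.choose α m * legSum wt ℓ m (chain m μ ν) * z ^ m)
      ((binomSum α (eta * (z • legMat wt ℓ)) * eta) μ ν) := by
  obtain ⟨f, hf⟩ := mul_eta_apply_linear μ ν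
  rw [← hf]
  have e : (fun m => Ring.choose α m * legSum wt ℓ m (chain m μ ν) * z ^ m) =
      fun m => Ring.choose α m • f ((eta * (z • legMat wt ℓ)) ^ m) := by
    funext m
    rw [hf, legSum_chain, Matrix.mul_smul, smul_pow, Matrix.smul_mul, Matrix.smul_apply,
      smul_eq_mul, smul_eq_mul]
    ring
  rw [e]
  exact hasSum_map_binomSum hα hz f

theorem hasExpansion_binomSum (ϰ : ℝ) {α : ℂ} (hα : ‖α‖ ≤ 1) (μ ν : Fin 4) :
    HasExpansion wt ℓ ϰ (fun z => (binomSum α (eta * (z • legMat wt ℓ)) * eta) μ ν)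
      (fun m a => Ring.choose α m * hRule ϰ m μ ν a) := by
  refine ⟨PowerSeries.mk fun m => Ring.choose α m * legSum wt ℓ m (chain m μ ν), ?_, fun m => ?_⟩
  · filter_upwards [eventually_norm_eta_mul_smul_lt (legMat wt ℓ) one_pos] with z hz
    simpa only [PowerSeries.coeff_mk] using hasSum_binomSum_mul_eta hα hz μ ν
  · rw [PowerSeries.coeff_mk, legSum_const_mul]
    unfold hRule
    rw [legSum_const_mul]
    ring

end

/-! ### Fourier modes -/

theorem lower_sum {ι : Type*} (s : Finset ι) (p : ι → Fin 4 → ℂ) (μ : Fin 4) :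
    lower (∑ i ∈ s, p i) μ = ∑ i ∈ s, lower (p i) μ := by
  simp only [lower, Finset.sum_apply, mul_sum]
  rw [sum_comm]

theorem mode_sum {ι : Type*} (s : Finset ι) (p : ι → Fin 4 → ℂ) (x : Spacetime) :
    mode (∑ i ∈ s, p i) x = ∏ i ∈ s, mode (p i) x := by
  simp only [mode, ← Complex.exp_sum, lower_sum, sum_mul]
  rw [sum_comm]

theorem mode_add (p q : Fin 4 → ℂ) (x : Spacetime) : mode (p + q) x = mode p x * mode q x := by
  simpa using mode_sum univ ![p, q] x

theorem mode_ne_zero (p : Fin 4 → ℂ) (x : Spacetime) : mode p x ≠ 0 := Complex.exp_ne_zero _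

/-- The coordinate `x^ρ`, as a complex valued functional. -/
def coordinate (ρ : Fin 4) : Spacetime →L[ℝ] ℂ :=
  Complex.ofRealCLM.comp (ContinuousLinearMap.proj ρ)

theorem coordinate_apply (ρ : Fin 4) (x : Spacetime) : coordinate ρ x = (x ρ : ℂ) := rfl

theorem norm_coordinate_le (ρ : Fin 4) : ‖coordinate ρ‖ ≤ 1 := by
  refine ContinuousLinearMap.opNorm_le_bound _ zero_le_one fun x => ?_
  rw [coordinate_apply, Complex.norm_real, one_mul]
  exact norm_le_pi_norm x ρ

theorem hasFDerivAt_mode (p : Fin 4 → ℂ) (x : Spacetime) :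
    HasFDerivAt (mode p) (∑ ρ, (lower p ρ * mode p x) • coordinate ρ) x := by
  have h1 : HasFDerivAt (fun y : Spacetime => ∑ ρ, lower p ρ * (y ρ : ℂ))
      (∑ ρ, lower p ρ • coordinate ρ) x :=
    HasFDerivAt.fun_sum fun ρ _ => (coordinate ρ).hasFDerivAt.const_mul (lower p ρ)
  have h2 := h1.cexp
  have e : ∑ ρ, (lower p ρ * mode p x) • coordinate ρ =
      Complex.exp (∑ ρ, lower p ρ * (x ρ : ℂ)) • ∑ ρ, lower p ρ • coordinate ρ := by
    rw [smul_sum]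
    refine sum_congr rfl fun ρ _ => ?_
    rw [smul_smul, mul_comm]
    rfl
  rw [e]
  exact h2

theorem sum_smul_coordinate_apply (f : Fin 4 → ℂ) (ρ : Fin 4) :
    (∑ σ, f σ • coordinate σ) (Pi.single ρ 1) = f ρ := by
  rw [_root_.sum_apply, sum_eq_single ρ]
  · simp [coordinate_apply]
  · intro σ _ hσ
    simp [coordinate_apply, hσ]
  · simp

section

variable {ι : Type*} [Fintype ι] (a : ι → Leg) (c : ι → ℂ)

/-- The graviton field `∑ j, c j • h j` of a superposition of Fourier modes. -/
def superposition (y : Spacetime) : Mat := ∑ j, c j • gravitonMode (a j) y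

/-- The legs of the modes of a superposition, with both orders of the two Lorentz indices. -/
def legOf (k : ι × Bool) : Leg := (a k.1).swapIf k.2

/-- The amplitudes of the legs of a superposition at the point `y`. -/
def amplitude (y : Spacetime) (k : ι × Bool) : ℂ := 1 / 2 * c k.1 * mode (a k.1).p y

omit [Fintype ι] in
theorem legOf_p (k : ι × Bool) : (legOf a k).p = (a k.1).p := by
  rw [legOf, Leg.swapIf]
  split_ifs <;> rfl

theorem legMat_amplitude (y : Spacetime) :
    legMat (amplitude a c y) (legOf a) = superposition a c y := by
  ext ρ σ
  rw [legMat_apply, Fintype.sum_prod_type, superposition, Matrix.sum_apply]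
  refine sum_congr rfl fun j _ => ?_
  rw [Fintype.sum_bool]
  simp only [amplitude, legOf, Leg.swapIf, gravitonMode, Matrix.smul_apply, Matrix.of_apply,
    smul_eq_mul, if_true, Bool.false_eq_true, if_false]
  ring

theorem superposition_isSymm (y : Spacetime) : (superposition a c y).IsSymm := by
  ext ρ σ
  simp only [Matrix.transpose_apply, superposition, Matrix.sum_apply, gravitonMode,
    Matrix.smul_apply, Matrix.of_apply]
  refine sum_congr rfl fun j _ => ?_
  congr 2
  ring

theorem continuous_mode (p : Fin 4 → ℂ) : Continuous (mode p) :=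
  continuous_iff_continuousAt.2 fun x => (hasFDerivAt_mode p x).continuousAt

theorem legSum_amplitude (y : Spacetime) (m : ℕ) (Φ : (ℕ → Leg) → ℂ) :
    legSum (amplitude a c y) (legOf a) m Φ = ∑ f : Fin m → ι × Bool,
      ((∏ i, (1 / 2 * c (f i).1)) * Φ (toSeq fun i => legOf a (f i))) *
        mode (∑ i, (legOf a (f i)).p) y := by
  refine sum_congr rfl fun f _ => ?_
  simp only [amplitude, legOf_p]
  rw [prod_mul_distrib, mode_sum]
  ring

/-- Differentiation of a product of Fourier modes multiplies it by the total momentum. -/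
theorem hasFDerivAt_legSum (x : Spacetime) (m : ℕ) (Φ : (ℕ → Leg) → ℂ) :
    HasFDerivAt (fun y => legSum (amplitude a c y) (legOf a) m Φ)
      (∑ ρ, legSum (amplitude a c x) (legOf a) m
        (fun b => (∑ i ∈ range m, lower (b i).p ρ) * Φ b) • coordinate ρ) x := by
  simp only [legSum_amplitude]
  refine HasFDerivAt.congr_fderiv
    (HasFDerivAt.fun_sum fun f _ => (hasFDerivAt_mode _ x).const_mul _) ?_
  simp only [smul_sum]
  rw [sum_comm]
  refine sum_congr rfl fun ρ _ => ?_
  refine ContinuousLinearMap.ext fun v => ?_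
  rw [_root_.sum_apply, _root_.smul_apply, smul_eq_mul, sum_mul]
  refine sum_congr rfl fun f _ => ?_
  rw [smul_smul, _root_.smul_apply, smul_eq_mul]
  congr 1
  have h2 : ∑ i ∈ range m, lower (toSeq (fun i => legOf a (f i)) i).p ρ =
      lower (∑ i, (legOf a (f i)).p) ρ := by
    rw [lower_sum, ← Fin.sum_univ_eq_sum_range
      fun i => lower (toSeq (fun i => legOf a (f i)) i).p ρ]
    refine sum_congr rfl fun i _ => ?_
    simp [toSeq]
  rw [h2]
  ring

end

theorem norm_legSum_le {K : Type*} [Fintype K] (wt : K → ℂ) (ℓ : K → Leg) (m : ℕ)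
    {Φ : (ℕ → Leg) → ℂ} {B : ℝ} (hΦ : ∀ f : Fin m → K, ‖Φ (toSeq fun i => ℓ (f i))‖ ≤ B) :
    ‖legSum wt ℓ m Φ‖ ≤ (∑ k, ‖wt k‖) ^ m * B := by
  rw [Fintype.sum_pow, sum_mul]
  refine norm_sum_le_of_le _ fun f _ => ?_
  rw [norm_mul, norm_prod]
  exact mul_le_mul_of_nonneg_left (hΦ f) (prod_nonneg fun _ _ => norm_nonneg _)

theorem norm_eta_le (μ ν : Fin 4) : ‖eta μ ν‖ ≤ 1 := by
  fin_cases μ <;> fin_cases ν <;> simp [eta]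

theorem norm_chain_le (m : ℕ) (μ ν : Fin 4) (a : ℕ → Leg) : ‖chain m μ ν a‖ ≤ 1 := by
  rw [chain, norm_prod]
  exact prod_le_one (fun _ _ => norm_nonneg _) fun _ _ => norm_eta_le _ _

section

variable {ι : Type*} [Fintype ι] (a : ι → Leg) (c : ι → ℂ)

/-- Uniform bounds near `x`, which make the radii of convergence uniform in the point. -/
theorem exists_amplitude_bound (x : Spacetime) :
    ∃ Q : ℝ, 0 < Q ∧ ∀ y ∈ Metric.ball x 1, ∑ k, ‖amplitude a c y k‖ ≤ Q ∧
      ‖eta * superposition a c y‖ ≤ Q := by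
  have h1 : Continuous fun y : Spacetime => ∑ k, ‖amplitude a c y k‖ := by
    refine continuous_finsetSum _ fun k _ => ?_
    exact (continuous_const.mul (continuous_mode _)).norm
  have h2 : Continuous fun y : Spacetime => ‖eta * superposition a c y‖ := by
    have e : ∀ y, eta * superposition a c y = ∑ j, (c j * mode (a j).p y) • (eta *
        Matrix.of fun ρ σ => (1 / 2) *
          (delta ρ (a j).μ * delta σ (a j).ν + delta σ (a j).μ * delta ρ (a j).ν)) := fun y => by
      rw [superposition, Matrix.mul_sum]
      refine sum_congr rfl fun j _ => ?_
      rw [← Matrix.mul_smul]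
      congr 1
      ext ρ σ
      simp only [gravitonMode, Matrix.smul_apply, Matrix.of_apply, smul_eq_mul]
      ring
    simp only [e]
    exact (continuous_finsetSum _ fun j _ =>
      (continuous_const.mul (continuous_mode _)).smul continuous_const).norm
  obtain ⟨Q₁, hQ₁⟩ := (isCompact_closedBall x 1).exists_bound_of_continuousOn h1.continuousOn
  obtain ⟨Q₂, hQ₂⟩ := (isCompact_closedBall x 1).exists_bound_of_continuousOn h2.continuousOn
  refine ⟨|Q₁| + |Q₂| + 1, by positivity, fun y hy => ?_⟩
  have h3 := (le_abs_self _).trans (hQ₁ y (Metric.ball_subset_closedBall hy))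
  have h4 := (le_abs_self _).trans (hQ₂ y (Metric.ball_subset_closedBall hy))
  have := le_abs_self Q₁
  have := le_abs_self Q₂
  constructor <;> linarith [abs_nonneg Q₁, abs_nonneg Q₂]

/-- Termwise differentiation of the binomial series of a superposition of Fourier modes. -/
theorem hasSum_pderiv_binomSum {α : ℂ} (hα : ‖α‖ ≤ 1) (x : Spacetime) (ρ μ ν : Fin 4) :
    ∀ᶠ z in 𝓝 (0 : ℂ),
      DifferentiableAt ℝ
        (fun y => (binomSum α (eta * (z • superposition a c y)) * eta) μ ν) x ∧
      HasSum (fun m => Ring.choose α m * legSum (amplitude a c x) (legOf a) m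
          (fun b => (∑ i ∈ range m, lower (b i).p ρ) * chain m μ ν b) * z ^ m)
        (pderiv ρ (fun y => (binomSum α (eta * (z • superposition a c y)) * eta) μ ν) x) := by
  obtain ⟨Q, hQ0, hQ⟩ := exists_amplitude_bound a c x
  have hsmall : ∀ᶠ z in 𝓝 (0 : ℂ), ‖z‖ * Q < 1 := by
    have : Continuous fun z : ℂ => ‖z‖ * Q := by fun_prop
    have h := this.tendsto 0
    simp only [norm_zero, zero_mul] at h
    exact h.eventually_lt_const one_pos
  filter_upwards [hsmall] with z hz
  set P : ℝ := ∑ σ, ∑ k, ‖lower (legOf a k).p σ‖ with hP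
  have hP0 : 0 ≤ P := sum_nonneg fun _ _ => sum_nonneg fun _ _ => norm_nonneg _
  have hlower : ∀ σ k, ‖lower (legOf a k).p σ‖ ≤ P := fun σ k =>
    (single_le_sum (f := fun k => ‖lower (legOf a k).p σ‖) (fun _ _ => norm_nonneg _)
      (mem_univ k)).trans (single_le_sum (f := fun σ => ∑ k, ‖lower (legOf a k).p σ‖)
        (fun _ _ => sum_nonneg fun _ _ => norm_nonneg _) (mem_univ σ))
  -- `D m σ` is the derivative in direction `σ` of the term `f m` of the series
  let D : ℕ → Fin 4 → Spacetime → ℂ := fun m σ y => Ring.choose α m * z ^ m *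
    legSum (amplitude a c y) (legOf a) m
      (fun b => (∑ i ∈ range m, lower (b i).p σ) * chain m μ ν b)
  let f : ℕ → Spacetime → ℂ := fun m y => Ring.choose α m * z ^ m *
    legSum (amplitude a c y) (legOf a) m (chain m μ ν)
  let f' : ℕ → Spacetime → Spacetime →L[ℝ] ℂ := fun m y => ∑ σ, D m σ y • coordinate σ
  -- `m` momenta occur in the derivative of a product of `m` modes
  let u : ℕ → ℝ := fun m => 4 * P * ((m : ℝ) ^ 1 * (‖z‖ * Q) ^ m)
  have hu : Summable u := by
    refine Summable.mul_left _ (summable_pow_mul_geometric_of_norm_lt_one 1 ?_)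
    rwa [Real.norm_of_nonneg (by positivity)]
  have hff' : ∀ m, ∀ y ∈ Metric.ball x 1, HasFDerivAt (f m) (f' m y) y := fun m y _ => by
    refine ((hasFDerivAt_legSum a c y m (chain m μ ν)).const_mul _).congr_fderiv ?_
    rw [smul_sum]
    exact sum_congr rfl fun σ _ => smul_smul _ _ _
  have hD : ∀ m σ, ∀ y ∈ Metric.ball x 1, ‖D m σ y‖ ≤ P * ((m : ℝ) ^ 1 * (‖z‖ * Q) ^ m) :=
      fun m σ y hy => by
    have h1 : ‖legSum (amplitude a c y) (legOf a) m
        (fun b => (∑ i ∈ range m, lower (b i).p σ) * chain m μ ν b)‖ ≤ Q ^ m * (m * P) := by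
      refine (norm_legSum_le _ _ m (B := m * P) fun g => ?_).trans
        (mul_le_mul_of_nonneg_right (pow_le_pow_left₀ (sum_nonneg fun _ _ => norm_nonneg _)
          (hQ y hy).1 m) (by positivity))
      rw [norm_mul]
      refine (mul_le_of_le_one_right (norm_nonneg _) (norm_chain_le _ _ _ _)).trans ?_
      refine (norm_sum_le_of_le _ (f := fun i => lower (toSeq (fun i => legOf a (g i)) i).p σ)
        (n := fun _ => P) fun i hi => ?_).trans (by simp)
      simp only [toSeq, mem_range.1 hi, dif_pos]
      exact hlower _ _
    rw [norm_mul, norm_mul, norm_pow]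
    calc ‖Ring.choose α m‖ * ‖z‖ ^ m * _ ≤ 1 * ‖z‖ ^ m * (Q ^ m * (m * P)) := by
          gcongr
          exact norm_choose_le_one hα m
      _ = _ := by rw [mul_pow]; ring
  have hbound : ∀ m, ∀ y ∈ Metric.ball x 1, ‖f' m y‖ ≤ u m := fun m y hy => by
    refine (norm_sum_le_of_le _ (n := fun _ => P * ((m : ℝ) ^ 1 * (‖z‖ * Q) ^ m))
      fun σ _ => ?_).trans ?_
    · rw [norm_smul]
      exact (mul_le_of_le_one_right (norm_nonneg _) (norm_coordinate_le σ)).trans (hD m σ y hy)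
    · simp only [sum_const, card_univ, Fintype.card_fin, u, nsmul_eq_mul]
      push_cast
      exact le_of_eq (by ring)
  have hx : x ∈ Metric.ball x 1 := Metric.mem_ball_self one_pos
  have hsum : ∀ y ∈ Metric.ball x 1,
      HasSum (fun m => f m y) ((binomSum α (eta * (z • superposition a c y)) * eta) μ ν) :=
      fun y hy => by
    have hy1 : ‖eta * (z • legMat (amplitude a c y) (legOf a))‖ < 1 := by
      rw [legMat_amplitude, Matrix.mul_smul, norm_smul]
      exact (mul_le_mul_of_nonneg_left (hQ y hy).2 (norm_nonneg z)).trans_lt hz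
    have h := hasSum_binomSum_mul_eta hα hy1 μ ν
    rw [legMat_amplitude] at h
    have e : (fun m => f m y) = fun m => Ring.choose α m *
        legSum (amplitude a c y) (legOf a) m (chain m μ ν) * z ^ m := by
      funext m
      simp only [f]
      ring
    rwa [e]
  have hderiv := hasFDerivAt_tsum_of_isPreconnected hu Metric.isOpen_ball
    (convex_ball x 1).isPreconnected hff' hbound hx (hsum x hx).summable hx
  have hderiv' := hderiv.congr_of_eventuallyEq
    (f₁ := fun y => (binomSum α (eta * (z • superposition a c y)) * eta) μ ν)
    (by
      filter_upwards [Metric.isOpen_ball.mem_nhds hx] with y hy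
      exact (hsum y hy).tsum_eq.symm)
  refine ⟨hderiv'.differentiableAt, ?_⟩
  rw [pderiv, hderiv'.fderiv]
  have hs : Summable fun m => f' m x := Summable.of_norm_bounded hu fun m => hbound m x hx
  have h := (ContinuousLinearMap.apply ℝ ℂ (Pi.single ρ (1 : ℝ) : Spacetime)).hasSum hs.hasSum
  have e : (fun m => Ring.choose α m * legSum (amplitude a c x) (legOf a) m
      (fun b => (∑ i ∈ range m, lower (b i).p ρ) * chain m μ ν b) * z ^ m) =
      fun m => (ContinuousLinearMap.apply ℝ ℂ (Pi.single ρ (1 : ℝ) : Spacetime)) (f' m x) := by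
    funext m
    rw [ContinuousLinearMap.apply_apply]
    simp only [f', sum_smul_coordinate_apply, D]
    ring
  rw [e]
  exact h

end

/-! ### Expansions of the metric dependent factors -/

/-- The Christoffel symbols with the last index lowered. -/
def christoffelLower (g : TensorField) (μ ν σ : Fin 4) (x : Spacetime) : ℂ :=
  (1 / 2) * (pderiv μ (fun y => g y σ ν) x + pderiv ν (fun y => g y μ σ) x
      - pderiv σ (fun y => g y μ ν) x)

theorem christoffel_eq (g : TensorField) (μ ν τ : Fin 4) (x : Spacetime) :
    christoffel g μ ν τ x = ∑ σ, (g x)⁻¹ τ σ * christoffelLower g μ ν σ x := by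
  rw [christoffel, mul_sum]
  refine sum_congr rfl fun σ _ => ?_
  rw [christoffelLower]
  ring

/-- The rule of a factor that is of first order in the graviton field. -/
def linearRule (φ : Leg → ℂ) (n : ℕ) (b : ℕ → Leg) : ℂ := if n = 1 then φ (b 0) else 0

theorem linearRule_dependsOnFirst (φ : Leg → ℂ) (n : ℕ) : DependsOnFirst n (linearRule φ n) := by
  intro a b h
  rw [linearRule, linearRule]
  split_ifs with hn
  · rw [h 0 (by omega)]
  · rfl

theorem hRule_dependsOnFirst (ϰ : ℝ) (α : ℕ → ℂ) (μ ν : Fin 4) (m : ℕ) :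
    DependsOnFirst m fun b => α m * hRule ϰ m μ ν b := by
  intro a b h
  simp only [hRule, chain_dependsOnFirst m μ ν a b h]

theorem hRule'_dependsOnFirst (ϰ : ℝ) (α : ℕ → ℂ) (ρ μ ν : Fin 4) (m : ℕ) :
    DependsOnFirst m fun b => α m * hRule' ϰ m ρ μ ν b := by
  intro a b h
  have : ∑ i ∈ range m, lower (a i).p ρ = ∑ i ∈ range m, lower (b i).p ρ :=
    sum_congr rfl fun i hi => by rw [h i (mem_range.1 hi)]
  simp only [hRule', chain_dependsOnFirst m μ ν a b h, this]

theorem smul_superposition_isSymm {ι : Type*} [Fintype ι] (a : ι → Leg) (c : ι → ℂ) (z : ℂ)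
    (y : Spacetime) : (z • superposition a c y).IsSymm :=
  (superposition_isSymm a c y).smul z

/-- Transposition of the vielbein by means of the Minkowski metric, in the symmetric gauge. -/
theorem vielbein_apply_eq {W : Mat} (hW : W.IsSymm) (hX : ‖eta * W‖ < 1 / 2) (t σ : Fin 4) :
    vielbein (eta + W) t σ =
      ∑ τ, eta σ τ * (binomSum (1 / 2) (eta * W) * eta) τ t := by
  have h := transpose_binomSum norm_one_half_le (X := eta * W) (by linarith)
    (by rwa [eta_mul_eta_mul])
  rw [vielbein_eq hW hX, ← Matrix.mul_apply, ← Matrix.mul_assoc, ← h, Matrix.mul_assoc,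
    eta_mul_eta, Matrix.mul_one, Matrix.transpose_apply]

section

variable {ι : Type*} [Fintype ι] (a : ι → Leg) (c : ι → ℂ) (x : Spacetime) (ϰ : ℝ)

/-- The metric `η + z h` of a superposition `h` of Fourier modes. -/
def metricOf (z : ℂ) : TensorField := fun y => eta + z • superposition a c y

/-- On a whole ball the metric is close to the Minkowski metric, so that the vielbein may be
differentiated at the centre. -/
theorem eventually_forall_norm_lt :
    ∀ᶠ z in 𝓝 (0 : ℂ), ∀ y ∈ Metric.ball x 1, ‖eta * (z • superposition a c y)‖ < 1 / 2 := by
  obtain ⟨Q, hQ0, hQ⟩ := exists_amplitude_bound a c x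
  have hsmall : ∀ᶠ z in 𝓝 (0 : ℂ), ‖z‖ * Q < 1 / 2 := by
    have : Continuous fun z : ℂ => ‖z‖ * Q := by fun_prop
    have h := this.tendsto 0
    simp only [norm_zero, zero_mul] at h
    exact h.eventually_lt_const (by norm_num)
  filter_upwards [hsmall] with z hz y hy
  rw [Matrix.mul_smul, norm_smul]
  exact (mul_le_mul_of_nonneg_left (hQ y hy).2 (norm_nonneg z)).trans_lt hz

theorem eventually_norm_lt :
    ∀ᶠ z in 𝓝 (0 : ℂ), ‖eta * (z • superposition a c x)‖ < 1 / 2 := by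
  filter_upwards [eventually_forall_norm_lt a c x] with z hz
  exact hz x (Metric.mem_ball_self one_pos)

theorem hasExpansion_volume :
    HasExpansion (amplitude a c x) (legOf a) ϰ (fun z => volDensity (metricOf a c z x))
      (vRule ϰ) := by
  have h := hasExpansion_volDensity (wt := amplitude a c x) (ℓ := legOf a)
    (by rw [legMat_amplitude]; exact superposition_isSymm a c x) ϰ
  simp only [legMat_amplitude] at h
  exact h

theorem hasExpansion_binomSum_superposition {α : ℂ} (hα : ‖α‖ ≤ 1) (μ ν : Fin 4) :
    HasExpansion (amplitude a c x) (legOf a) ϰ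
      (fun z => (binomSum α (eta * (z • superposition a c x)) * eta) μ ν)
      (fun m b => Ring.choose α m * hRule ϰ m μ ν b) := by
  have h := hasExpansion_binomSum (wt := amplitude a c x) (ℓ := legOf a) ϰ hα μ ν
  simpa only [legMat_amplitude] using h

theorem hasExpansion_inv_metric (μ ν : Fin 4) :
    HasExpansion (amplitude a c x) (legOf a) ϰ (fun z => (metricOf a c z x)⁻¹ μ ν)
      (fun m b => (-1) ^ m * hRule ϰ m μ ν b) := by
  have h := hasExpansion_binomSum_superposition a c x ϰ norm_neg_one_le μ ν
  simp only [choose_neg_one] at h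
  refine h.congr ?_
  filter_upwards [eventually_norm_lt a c x] with z hz
  rw [metricOf, inv_metric_eq hz]

theorem hasExpansion_invVielbein (ρ r : Fin 4) :
    HasExpansion (amplitude a c x) (legOf a) ϰ (fun z => invVielbein (metricOf a c z x) ρ r)
      (fun m b => binomNegHalf m * hRule ϰ m ρ r b) := by
  refine (hasExpansion_binomSum_superposition a c x ϰ norm_neg_one_half_le ρ r).congr ?_
  filter_upwards [eventually_norm_lt a c x] with z hz
  rw [metricOf, invVielbein, inv_vielbein_eq (smul_superposition_isSymm a c z x) hz]

/-- The vielbein with its curved index raised and put first, `η^{τσ} e_σ^t`. -/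
def raisedVielbein (g : Mat) (τ t : Fin 4) : ℂ := (vielbein g * eta) τ t

theorem hasExpansion_raisedVielbein (τ t : Fin 4) :
    HasExpansion (amplitude a c x) (legOf a) ϰ (fun z => raisedVielbein (metricOf a c z x) τ t)
      (fun m b => binomHalf m * hRule ϰ m τ t b) := by
  refine (hasExpansion_binomSum_superposition a c x ϰ norm_one_half_le τ t).congr ?_
  filter_upwards [eventually_norm_lt a c x] with z hz
  rw [metricOf, raisedVielbein, vielbein_eq (smul_superposition_isSymm a c z x) hz]

theorem eventually_vielbein_eq :
    ∀ᶠ z in 𝓝 (0 : ℂ), ∀ t σ, vielbein (metricOf a c z x) t σ =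
      ∑ τ, eta σ τ * raisedVielbein (metricOf a c z x) τ t := by
  filter_upwards [eventually_norm_lt a c x] with z hz t σ
  have hW := smul_superposition_isSymm a c z x
  rw [metricOf, vielbein_apply_eq hW hz]
  simp only [raisedVielbein, vielbein_eq hW hz]

theorem hasExpansion_pderiv_raisedVielbein (ρ τ t : Fin 4) :
    HasExpansion (amplitude a c x) (legOf a) ϰ
      (fun z => pderiv ρ (fun y => raisedVielbein (metricOf a c z y) τ t) x)
      (fun m b => binomHalf m * hRule' ϰ m ρ τ t b) := by
  refine ⟨PowerSeries.mk fun m => Ring.choose (1 / 2 : ℂ) m *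
    legSum (amplitude a c x) (legOf a) m
      (fun b => (∑ i ∈ range m, lower (b i).p ρ) * chain m τ t b), ?_, fun m => ?_⟩
  · filter_upwards [hasSum_pderiv_binomSum a c norm_one_half_le x ρ τ t,
      eventually_forall_norm_lt a c x] with z h hz
    have e : pderiv ρ (fun y => raisedVielbein (metricOf a c z y) τ t) x = pderiv ρ
        (fun y => (binomSum (1 / 2) (eta * (z • superposition a c y)) * eta) τ t) x := by
      rw [pderiv, pderiv]
      congr 1
      refine Filter.EventuallyEq.fderiv_eq ?_
      filter_upwards [Metric.ball_mem_nhds x one_pos] with y hy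
      rw [metricOf, raisedVielbein, vielbein_eq (smul_superposition_isSymm a c z y) (hz y hy)]
    rw [e]
    simpa only [PowerSeries.coeff_mk] using h.2
  · rw [PowerSeries.coeff_mk, legSum_const_mul]
    unfold hRule'
    simp only [mul_assoc]
    rw [legSum_const_mul]
    simp only [binomHalf]
    ring

theorem eventually_pderiv_vielbein_eq :
    ∀ᶠ z in 𝓝 (0 : ℂ), ∀ ρ t σ, pderiv ρ (fun y => vielbein (metricOf a c z y) t σ) x =
      ∑ τ, eta σ τ * pderiv ρ (fun y => raisedVielbein (metricOf a c z y) τ t) x := by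
  have hd : ∀ᶠ z in 𝓝 (0 : ℂ), ∀ τ t, DifferentiableAt ℝ
      (fun y => (binomSum (1 / 2) (eta * (z • superposition a c y)) * eta) τ t) x := by
    refine eventually_all.2 fun τ => eventually_all.2 fun t => ?_
    exact (hasSum_pderiv_binomSum a c norm_one_half_le x 0 τ t).mono fun z h => h.1
  filter_upwards [hd, eventually_forall_norm_lt a c x] with z hd hz ρ t σ
  have hnear : ∀ y ∈ Metric.ball x 1, vielbein (metricOf a c z y) =
      binomSum (1 / 2) (eta * (z • superposition a c y)) := fun y hy =>
    vielbein_eq (smul_superposition_isSymm a c z y) (hz y hy)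
  have hR : ∀ τ, HasFDerivAt (fun y => raisedVielbein (metricOf a c z y) τ t)
      (fderiv ℝ (fun y => raisedVielbein (metricOf a c z y) τ t) x) x := fun τ => by
    refine DifferentiableAt.hasFDerivAt ((hd τ t).congr_of_eventuallyEq ?_)
    filter_upwards [Metric.ball_mem_nhds x one_pos] with y hy
    rw [raisedVielbein, hnear y hy]
  have h := HasFDerivAt.fun_sum fun τ (_ : τ ∈ univ) => (hR τ).const_mul (eta σ τ)
  have h2 := h.congr_of_eventuallyEq (f₁ := fun y => vielbein (metricOf a c z y) t σ) (by
    filter_upwards [Metric.ball_mem_nhds x one_pos] with y hy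
    have hW := smul_superposition_isSymm a c z y
    rw [metricOf, vielbein_apply_eq hW (hz y hy)]
    simp only [raisedVielbein, vielbein_eq hW (hz y hy)])
  rw [pderiv, h2.fderiv, _root_.sum_apply]
  rfl

theorem pderiv_metricOf (z : ℂ) (ρ μ ν : Fin 4) :
    pderiv ρ (fun y => metricOf a c z y μ ν) x = z * ∑ j, c j *
      ((1 / 2) * (delta μ (a j).μ * delta ν (a j).ν + delta ν (a j).μ * delta μ (a j).ν) *
        (lower (a j).p ρ * mode (a j).p x)) := by
  have h : HasFDerivAt (fun y => metricOf a c z y μ ν) (z • ∑ j, c j •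
      ((1 / 2) * (delta μ (a j).μ * delta ν (a j).ν + delta ν (a j).μ * delta μ (a j).ν)) •
        (∑ ρ, (lower (a j).p ρ * mode (a j).p x) • coordinate ρ)) x := by
    have h1 := ((HasFDerivAt.fun_sum fun j (_ : j ∈ univ) =>
      ((hasFDerivAt_mode (a j).p x).const_mul ((1 / 2) * (delta μ (a j).μ * delta ν (a j).ν +
        delta ν (a j).μ * delta μ (a j).ν))).const_mul (c j)).const_mul z).const_add (eta μ ν)
    refine h1.congr_of_eventuallyEq (Eventually.of_forall fun y => ?_)
    simp only [metricOf, superposition, Matrix.add_apply, Matrix.smul_apply, Matrix.sum_apply,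
      gravitonMode, Matrix.of_apply, smul_eq_mul]
  rw [pderiv, h.fderiv, _root_.smul_apply, _root_.sum_apply, smul_eq_mul]
  congr 1
  refine sum_congr rfl fun j _ => ?_
  rw [_root_.smul_apply, _root_.smul_apply, sum_smul_coordinate_apply]
  simp only [smul_eq_mul]

theorem hasExpansion_christoffelLower (μ ν σ : Fin 4) :
    HasExpansion (amplitude a c x) (legOf a) ϰ
      (fun z => christoffelLower (metricOf a c z) μ ν σ x)
      (linearRule (gammaRule ϰ μ ν σ)) := by
  set G : ℂ := ∑ j, c j * (1 / 4 *
    (lower (a j).p μ * (delta σ (a j).μ * delta ν (a j).ν + delta ν (a j).μ * delta σ (a j).ν) +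
      lower (a j).p ν * (delta μ (a j).μ * delta σ (a j).ν + delta σ (a j).μ * delta μ (a j).ν) -
      lower (a j).p σ * (delta μ (a j).μ * delta ν (a j).ν + delta ν (a j).μ * delta μ (a j).ν)) *
      mode (a j).p x) with hG
  refine ⟨_, (hasTaylor_id.mul (hasTaylor_const G)).congr (Eventually.of_forall fun z => ?_),
    fun n => ?_⟩
  · simp only [christoffelLower, pderiv_metricOf, hG]
    rw [← mul_add, ← mul_sub, ← sum_add_distrib, ← sum_sub_distrib, mul_left_comm]
    congr 1
    rw [mul_sum]
    exact sum_congr rfl fun j _ => by ring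
  · rw [PowerSeries.coeff_mul_C, PowerSeries.coeff_X]
    by_cases hn : n = 1
    · subst hn
      have h1 : linearRule (gammaRule ϰ μ ν σ) 1 = fun b => gammaRule ϰ μ ν σ (b 0) := by
        funext b
        simp [linearRule]
      rw [h1, legSum_one, Fintype.sum_prod_type, if_pos rfl, one_mul, pow_one, hG, mul_sum]
      refine sum_congr rfl fun j _ => ?_
      rw [Fintype.sum_bool]
      simp only [amplitude, legOf, Leg.swapIf, gammaRule, if_true, Bool.false_eq_true, if_false]
      ring
    · simp [linearRule, hn, legSum]

/-- In the symmetric gauge, `e_τ^t Γ_{ρσ}^τ = e^{τt} Γ_{ρστ}`. -/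
theorem eventually_vielbein_mul_christoffel :
    ∀ᶠ z in 𝓝 (0 : ℂ), ∀ t ρ σ,
      ∑ τ, vielbein (metricOf a c z x) t τ * christoffel (metricOf a c z) ρ σ τ x =
        ∑ τ, invVielbein (metricOf a c z x) τ t * christoffelLower (metricOf a c z) ρ σ τ x := by
  filter_upwards [eventually_norm_lt a c x] with z hz t ρ σ
  simp only [christoffel_eq, mul_sum, ← mul_assoc]
  rw [sum_comm]
  refine sum_congr rfl fun τ _ => ?_
  rw [← sum_mul]
  congr 1
  exact vielbein_mul_inv_metric (smul_superposition_isSymm a c z x) hz t τ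

end

end Blocks

/-! ### Splitting a list of gravitons into blocks -/

theorem sum_antidiagonalTuple_succ {k n : ℕ} (F : (Fin (k + 1) → ℕ) → ℂ) :
    ∑ m ∈ Finset.Nat.antidiagonalTuple (k + 1) n, F m =
      ∑ ij ∈ antidiagonal n, ∑ m ∈ Finset.Nat.antidiagonalTuple k ij.2,
        F (Matrix.vecCons ij.1 m) := by
  rw [sum_sigma']
  refine sum_bij' (fun m _ => ⟨(m 0, n - m 0), Fin.tail m⟩)
    (fun p _ => Matrix.vecCons p.1.1 p.2) ?_ ?_ ?_ ?_ ?_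
  · intro m hm
    rw [Finset.Nat.mem_antidiagonalTuple, Fin.sum_univ_succ] at hm
    simp only [mem_sigma, HasAntidiagonal.mem_antidiagonal, Finset.Nat.mem_antidiagonalTuple,
      Fin.tail]
    omega
  · intro p hp
    simp only [mem_sigma, HasAntidiagonal.mem_antidiagonal, Finset.Nat.mem_antidiagonalTuple] at hp
    rw [Finset.Nat.mem_antidiagonalTuple, Fin.sum_univ_succ]
    simp only [Matrix.cons_val_zero, Matrix.cons_val_succ]
    omega
  · intro m _
    exact Fin.cons_self_tail m
  · rintro ⟨⟨i, j⟩, m⟩ hp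
    simp only [mem_sigma, HasAntidiagonal.mem_antidiagonal, Finset.Nat.mem_antidiagonalTuple] at hp
    obtain ⟨h1, h2⟩ := hp
    have h3 : j = n - i := by omega
    subst h3
    rfl
  · intro m _
    exact congrArg F (Fin.cons_self_tail m).symm

theorem shift_eq (m : ℕ) (a : ℕ → Leg) : shift m a = fun i => a (m + i) := rfl

theorem splittings_zero (r n : ℕ) : splittings r n 0 = Finset.Nat.antidiagonalTuple r n := by
  simp [splittings]

section

variable (Φ₁ Φ₂ Φ₃ Φ₄ Ψ : ℕ → (ℕ → Leg) → ℂ) (n : ℕ) (b : ℕ → Leg)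

theorem conv_eq_sum_two :
    conv Φ₁ Ψ n b = ∑ m ∈ splittings 2 n 0, Φ₁ (m 0) b * Ψ (m 1) (shift (m 0) b) := by
  simp only [splittings_zero, sum_antidiagonalTuple_succ, Finset.Nat.antidiagonalTuple_one,
    sum_singleton, conv]
  rfl

theorem conv_eq_sum_three :
    conv Φ₁ (conv Φ₂ Ψ) n b = ∑ m ∈ splittings 3 n 0,
      Φ₁ (m 0) b * (Φ₂ (m 1) (shift (m 0) b) * Ψ (m 2) (shift (m 0 + m 1) b)) := by
  rw [conv]
  simp only [conv_eq_sum_two, splittings_zero, sum_antidiagonalTuple_succ (k := 2), mul_sum,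
    shift_shift]
  rfl

theorem conv_eq_sum_four :
    conv Φ₁ (conv Φ₂ (conv Φ₃ Ψ)) n b = ∑ m ∈ splittings 4 n 0,
      Φ₁ (m 0) b * (Φ₂ (m 1) (shift (m 0) b) * (Φ₃ (m 2) (shift (m 0 + m 1) b) *
        Ψ (m 3) (shift (m 0 + m 1 + m 2) b))) := by
  rw [conv]
  simp only [conv_eq_sum_three, splittings_zero, sum_antidiagonalTuple_succ (k := 3), mul_sum,
    shift_shift, Nat.add_assoc]
  rfl

theorem conv_eq_sum_five :
    conv Φ₁ (conv Φ₂ (conv Φ₃ (conv Φ₄ Ψ))) n b = ∑ m ∈ splittings 5 n 0,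
      Φ₁ (m 0) b * (Φ₂ (m 1) (shift (m 0) b) * (Φ₃ (m 2) (shift (m 0 + m 1) b) *
        (Φ₄ (m 3) (shift (m 0 + m 1 + m 2) b) *
          Ψ (m 4) (shift (m 0 + m 1 + m 2 + m 3) b)))) := by
  rw [conv]
  simp only [conv_eq_sum_four, splittings_zero, sum_antidiagonalTuple_succ (k := 4), mul_sum,
    shift_shift, Nat.add_assoc]
  rfl

theorem conv_linearRule (φ : Leg → ℂ) :
    conv (linearRule φ) Ψ n b = if 1 ≤ n then φ (b 0) * Ψ (n - 1) (shift 1 b) else 0 := by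
  split_ifs with h
  · rw [conv, sum_eq_single (1, n - 1)]
    · simp [linearRule]
    · intro ij _ hne
      have : ij.1 ≠ 1 := fun h1 => hne (Prod.ext h1 (by
        have := HasAntidiagonal.mem_antidiagonal.1 ‹_›
        simp only
        omega))
      simp [linearRule, this]
    · intro hn
      exact absurd (HasAntidiagonal.mem_antidiagonal.2 (by simp only; omega)) hn
  · have h0 : n = 0 := by omega
    subst h0
    simp [conv, linearRule]

theorem sum_splittings_add (r d : ℕ) (F : (Fin r → ℕ) → ℂ) :
    ∑ m ∈ splittings r n d, F m = if d ≤ n then ∑ m ∈ splittings r (n - d) 0, F m else 0 := by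
  rw [splittings_zero, splittings]
  split_ifs <;> simp

end

/-! ### Expansions of the Lagrange densities -/

theorem matterLagrangian_smul (k : MatterType) (g : TensorField) (T : MatterTensor k)
    (f : Spacetime → ℂ) (x : Spacetime) :
    matterLagrangian k g (fun y => f y • T) x = f x * matterLagrangian k g (fun _ => T) x := by
  rw [matterLagrangian, matterLagrangian, ← mul_assoc]
  congr 1
  cases k <;> simp only [matterScalar, mul_sum]
  case type1 => rfl
  all_goals
    repeat' refine sum_congr rfl fun _ _ => ?_
    exact mul_left_comm _ _ _

theorem sum_reorder_five (f : Fin 4 → Fin 4 → Fin 4 → Fin 4 → Fin 4 → ℂ) :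
    ∑ ρ, ∑ r, ∑ σ, ∑ s, ∑ t, f ρ r σ s t = ∑ r, ∑ s, ∑ t, ∑ ρ, ∑ σ, f ρ r σ s t := by
  rw [sum_comm]
  refine sum_congr rfl fun r _ => ?_
  calc ∑ ρ, ∑ σ, ∑ s, ∑ t, f ρ r σ s t = ∑ ρ, ∑ s, ∑ t, ∑ σ, f ρ r σ s t :=
        sum_congr rfl fun ρ _ => sum_comm.trans (sum_congr rfl fun s _ => sum_comm)
    _ = ∑ s, ∑ t, ∑ ρ, ∑ σ, f ρ r σ s t :=
        sum_comm.trans (sum_congr rfl fun s _ => sum_comm)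

section

variable {ι : Type*} [Fintype ι] (a : ι → Leg) (c : ι → ℂ) (x : Spacetime) (ϰ : ℝ)

theorem hasExpansion_type1 (T : MatterTensor .type1) :
    HasExpansion (amplitude a c x) (legOf a) ϰ
      (fun z => matterLagrangian .type1 (metricOf a c z) (fun _ => T) x)
      (fun n b => mRule ϰ n .type1 T b) :=
  (hasExpansion_volume a c x ϰ).const_mul _

theorem hasExpansion_type2 (T : MatterTensor .type2) :
    HasExpansion (amplitude a c x) (legOf a) ϰ
      (fun z => matterLagrangian .type2 (metricOf a c z) (fun _ => T) x)
      (fun n b => mRule ϰ n .type2 T b) := by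
  refine ((HasExpansion.sum univ fun μ _ => HasExpansion.sum univ fun ν _ =>
    ((hasExpansion_inv_metric a c x ϰ μ ν).mul (hasExpansion_volume a c x ϰ)
      (hRule_dependsOnFirst ϰ _ μ ν)).const_mul (T ![μ, ν])).congr
      (Eventually.of_forall fun z => ?_)).congr_rule fun n b => ?_
  · simp only [matterLagrangian, matterScalar, sum_mul]
    refine sum_congr rfl fun μ _ => sum_congr rfl fun ν _ => ?_
    ring
  · simp only [mRule, conv_eq_sum_two, shift_eq]

theorem hasExpansion_type3 (T : MatterTensor .type3) :
    HasExpansion (amplitude a c x) (legOf a) ϰ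
      (fun z => matterLagrangian .type3 (metricOf a c z) (fun _ => T) x)
      (fun n b => mRule ϰ n .type3 T b) := by
  refine ((HasExpansion.sum univ fun μ _ => HasExpansion.sum univ fun ν _ =>
    HasExpansion.sum univ fun ρ _ => HasExpansion.sum univ fun σ _ =>
    ((hasExpansion_inv_metric a c x ϰ μ ν).mul
      ((hasExpansion_inv_metric a c x ϰ ρ σ).mul (hasExpansion_volume a c x ϰ)
        (hRule_dependsOnFirst ϰ _ ρ σ))
      (hRule_dependsOnFirst ϰ _ μ ν)).const_mul (T ![μ, ν, ρ, σ])).congr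
      (Eventually.of_forall fun z => ?_)).congr_rule fun n b => ?_
  · simp only [matterLagrangian, matterScalar, sum_mul]
    refine sum_congr rfl fun μ _ => sum_congr rfl fun ν _ =>
      sum_congr rfl fun ρ _ => sum_congr rfl fun σ _ => ?_
    ring
  · simp only [mRule, conv_eq_sum_three, shift_eq]
    refine sum_congr rfl fun μ _ => sum_congr rfl fun ν _ =>
      sum_congr rfl fun ρ _ => sum_congr rfl fun σ _ => ?_
    congr 1
    exact sum_congr rfl fun m _ => by ring

theorem hasExpansion_type4 (T : MatterTensor .type4) :
    HasExpansion (amplitude a c x) (legOf a) ϰ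
      (fun z => matterLagrangian .type4 (metricOf a c z) (fun _ => T) x)
      (fun n b => mRule ϰ n .type4 T b) := by
  refine ((HasExpansion.sum univ fun μ _ => HasExpansion.sum univ fun ν _ =>
    HasExpansion.sum univ fun ρ _ => HasExpansion.sum univ fun σ _ =>
    ((hasExpansion_christoffelLower a c x ϰ μ ν σ).mul
    ((hasExpansion_inv_metric a c x ϰ μ ν).mul
      ((hasExpansion_inv_metric a c x ϰ ρ σ).mul (hasExpansion_volume a c x ϰ)
        (hRule_dependsOnFirst ϰ _ ρ σ))
      (hRule_dependsOnFirst ϰ _ μ ν)) (linearRule_dependsOnFirst _)).const_mul (T ![ρ])).congr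
      (Eventually.of_forall fun z => ?_)).congr_rule fun n b => ?_
  · simp only [matterLagrangian, matterScalar, christoffel_eq, sum_mul, mul_sum]
    refine sum_congr rfl fun μ _ => sum_congr rfl fun ν _ =>
      sum_congr rfl fun ρ _ => sum_congr rfl fun σ _ => ?_
    ring
  · simp only [mRule, conv_linearRule, sum_splittings_add _ _ 1]
    simp only [conv_eq_sum_three, shift_shift]
    refine sum_congr rfl fun μ _ => sum_congr rfl fun ν _ =>
      sum_congr rfl fun ρ _ => sum_congr rfl fun σ _ => ?_
    split_ifs
    · rw [mul_assoc]
      congr 2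
      refine sum_congr rfl fun m _ => ?_
      simp only [shift_eq, ← Nat.add_assoc]
      ring
    · simp

theorem hasExpansion_type5 (T : MatterTensor .type5) :
    HasExpansion (amplitude a c x) (legOf a) ϰ
      (fun z => matterLagrangian .type5 (metricOf a c z) (fun _ => T) x)
      (fun n b => mRule ϰ n .type5 T b) := by
  refine ((HasExpansion.sum univ fun μ _ => HasExpansion.sum univ fun ν _ =>
    HasExpansion.sum univ fun ρ _ => HasExpansion.sum univ fun σ _ =>
    HasExpansion.sum univ fun κ _ => HasExpansion.sum univ fun l _ =>
    ((hasExpansion_christoffelLower a c x ϰ μ ν l).mul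
    ((hasExpansion_inv_metric a c x ϰ μ ν).mul
      ((hasExpansion_inv_metric a c x ϰ ρ σ).mul
        ((hasExpansion_inv_metric a c x ϰ κ l).mul (hasExpansion_volume a c x ϰ)
          (hRule_dependsOnFirst ϰ _ κ l))
        (hRule_dependsOnFirst ϰ _ ρ σ))
      (hRule_dependsOnFirst ϰ _ μ ν)) (linearRule_dependsOnFirst _)).const_mul
        (T ![ρ, σ, κ])).congr
      (Eventually.of_forall fun z => ?_)).congr_rule fun n b => ?_
  · simp only [matterLagrangian, matterScalar, christoffel_eq, sum_mul, mul_sum]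
    refine sum_congr rfl fun μ _ => sum_congr rfl fun ν _ =>
      sum_congr rfl fun ρ _ => sum_congr rfl fun σ _ =>
      sum_congr rfl fun κ _ => sum_congr rfl fun l _ => ?_
    ring
  · simp only [mRule, conv_linearRule, sum_splittings_add _ _ 1]
    simp only [conv_eq_sum_four, shift_shift]
    refine sum_congr rfl fun μ _ => sum_congr rfl fun ν _ =>
      sum_congr rfl fun ρ _ => sum_congr rfl fun σ _ =>
      sum_congr rfl fun κ _ => sum_congr rfl fun l _ => ?_
    split_ifs
    · rw [mul_assoc]
      congr 2
      refine sum_congr rfl fun m _ => ?_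
      simp only [shift_eq, ← Nat.add_assoc]
      ring
    · simp

theorem hasExpansion_type6 (T : MatterTensor .type6) :
    HasExpansion (amplitude a c x) (legOf a) ϰ
      (fun z => matterLagrangian .type6 (metricOf a c z) (fun _ => T) x)
      (fun n b => mRule ϰ n .type6 T b) := by
  refine ((HasExpansion.sum univ fun μ _ => HasExpansion.sum univ fun ν _ =>
    HasExpansion.sum univ fun ρ _ => HasExpansion.sum univ fun σ _ =>
    HasExpansion.sum univ fun κ _ => HasExpansion.sum univ fun l _ =>
    HasExpansion.sum univ fun ι _ => HasExpansion.sum univ fun τ _ =>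
    ((hasExpansion_christoffelLower a c x ϰ μ ν l).mul
    ((hasExpansion_christoffelLower a c x ϰ ρ σ τ).mul
    ((hasExpansion_inv_metric a c x ϰ μ ν).mul
      ((hasExpansion_inv_metric a c x ϰ ρ σ).mul
        ((hasExpansion_inv_metric a c x ϰ κ l).mul
          ((hasExpansion_inv_metric a c x ϰ ι τ).mul (hasExpansion_volume a c x ϰ)
            (hRule_dependsOnFirst ϰ _ ι τ))
          (hRule_dependsOnFirst ϰ _ κ l))
        (hRule_dependsOnFirst ϰ _ ρ σ))
      (hRule_dependsOnFirst ϰ _ μ ν)) (linearRule_dependsOnFirst _))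
      (linearRule_dependsOnFirst _)).const_mul
        (T ![κ, ι])).congr
      (Eventually.of_forall fun z => ?_)).congr_rule fun n b => ?_
  · simp only [matterLagrangian, matterScalar, christoffel_eq]
    rw [sum_mul]
    refine sum_congr rfl fun μ _ => ?_
    rw [sum_mul]
    refine sum_congr rfl fun ν _ => ?_
    rw [sum_mul]
    refine sum_congr rfl fun ρ _ => ?_
    rw [sum_mul]
    refine sum_congr rfl fun σ _ => ?_
    rw [sum_mul]
    refine sum_congr rfl fun κ _ => ?_
    rw [sum_mul, sum_comm]
    refine sum_congr rfl fun ι _ => ?_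
    rw [mul_assoc, mul_assoc, mul_assoc, sum_mul, mul_sum]
    refine sum_congr rfl fun l _ => ?_
    rw [sum_mul, mul_sum, mul_sum]
    refine sum_congr rfl fun τ _ => ?_
    ring
  · simp only [mRule, conv_linearRule, sum_splittings_add _ _ 2]
    simp only [conv_eq_sum_five, shift_shift]
    refine sum_congr rfl fun μ _ => sum_congr rfl fun ν _ =>
      sum_congr rfl fun ρ _ => sum_congr rfl fun σ _ =>
      sum_congr rfl fun κ _ => sum_congr rfl fun l _ =>
      sum_congr rfl fun ι _ => sum_congr rfl fun τ _ => ?_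
    by_cases hn : 2 ≤ n
    · rw [if_pos (by omega), if_pos (by omega), if_pos hn, Nat.sub_sub, mul_assoc, mul_assoc]
      congr 3
      refine sum_congr rfl fun m _ => ?_
      simp only [shift_eq, ← Nat.add_assoc]
      ring
    · rw [if_neg hn]
      split_ifs
      · omega
      · simp
      · simp

theorem hasExpansion_type7 (T : MatterTensor .type7) :
    HasExpansion (amplitude a c x) (legOf a) ϰ
      (fun z => matterLagrangian .type7 (metricOf a c z) (fun _ => T) x)
      (fun n b => mRule ϰ n .type7 T b) := by
  refine ((HasExpansion.sum univ fun o _ => HasExpansion.sum univ fun υ _ =>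
    ((hasExpansion_raisedVielbein a c x ϰ υ o).mul (hasExpansion_volume a c x ϰ)
      (hRule_dependsOnFirst ϰ _ υ o)).const_mul (T ![o] * eta 0 υ)).congr ?_).congr_rule
      fun n b => ?_
  · filter_upwards [eventually_vielbein_eq a c x] with z hz
    simp only [matterLagrangian, matterScalar, hz, sum_mul]
    refine sum_congr rfl fun o _ => sum_congr rfl fun υ _ => ?_
    ring
  · simp only [mRule, conv_eq_sum_two, shift_eq]
    refine sum_congr rfl fun o _ => sum_congr rfl fun υ _ => ?_
    rw [mul_assoc, mul_sum]
    congr 1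
    exact sum_congr rfl fun m _ => by ring

theorem hasExpansion_type8 (T : MatterTensor .type8) :
    HasExpansion (amplitude a c x) (legOf a) ϰ
      (fun z => matterLagrangian .type8 (metricOf a c z) (fun _ => T) x)
      (fun n b => mRule ϰ n .type8 T b) := by
  refine ((HasExpansion.sum univ fun o _ => HasExpansion.sum univ fun ρ _ =>
    HasExpansion.sum univ fun r _ => HasExpansion.sum univ fun υ _ =>
    ((hasExpansion_raisedVielbein a c x ϰ υ o).mul
      ((hasExpansion_invVielbein a c x ϰ ρ r).mul (hasExpansion_volume a c x ϰ)
        (hRule_dependsOnFirst ϰ _ ρ r))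
      (hRule_dependsOnFirst ϰ _ υ o)).const_mul (T ![o, ρ, r] * eta 0 υ)).congr ?_).congr_rule
      fun n b => ?_
  · filter_upwards [eventually_vielbein_eq a c x] with z hz
    simp only [matterLagrangian, matterScalar, hz, sum_mul]
    refine sum_congr rfl fun o _ => sum_congr rfl fun ρ _ =>
      sum_congr rfl fun r _ => sum_congr rfl fun υ _ => ?_
    ring
  · simp only [mRule, conv_eq_sum_three, shift_eq]
    refine sum_congr rfl fun o _ => sum_congr rfl fun ρ _ =>
      sum_congr rfl fun r _ => sum_congr rfl fun υ _ => ?_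
    rw [mul_assoc, mul_sum]
    congr 1
    exact sum_congr rfl fun m _ => by ring

theorem hasExpansion_type9 (T : MatterTensor .type9) :
    HasExpansion (amplitude a c x) (legOf a) ϰ
      (fun z => matterLagrangian .type9 (metricOf a c z) (fun _ => T) x)
      (fun n b => mRule ϰ n .type9 T b) := by
  refine ((HasExpansion.sum univ fun o _ => HasExpansion.sum univ fun r _ =>
    HasExpansion.sum univ fun s _ => HasExpansion.sum univ fun t _ =>
    HasExpansion.sum univ fun υ _ => HasExpansion.sum univ fun ρ _ =>
    HasExpansion.sum univ fun σ _ => HasExpansion.sum univ fun τ _ =>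
    ((hasExpansion_raisedVielbein a c x ϰ υ o).mul
      ((hasExpansion_invVielbein a c x ϰ ρ r).mul
        ((hasExpansion_invVielbein a c x ϰ σ s).mul
          ((hasExpansion_pderiv_raisedVielbein a c x ϰ ρ τ t).mul (hasExpansion_volume a c x ϰ)
            (hRule'_dependsOnFirst ϰ _ ρ τ t))
          (hRule_dependsOnFirst ϰ _ σ s))
        (hRule_dependsOnFirst ϰ _ ρ r))
      (hRule_dependsOnFirst ϰ _ υ o)).const_mul
        (T ![o, r, s, t] * eta 0 υ * eta σ τ)).congr ?_).congr_rule fun n b => ?_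
  · filter_upwards [eventually_vielbein_eq a c x, eventually_pderiv_vielbein_eq a c x] with z hz hz'
    simp only [matterLagrangian, matterScalar, hz, hz']
    rw [eq_comm, sum_mul]
    refine sum_congr rfl fun o _ => ?_
    rw [sum_reorder_five]
    rw [sum_mul]
    refine sum_congr rfl fun r _ => ?_
    rw [sum_mul]
    refine sum_congr rfl fun s _ => ?_
    rw [sum_mul]
    refine sum_congr rfl fun t _ => ?_
    rw [sum_mul]
    refine Eq.trans ?_ (sum_comm.trans (sum_congr rfl fun ρ _ => sum_comm)).symm
    refine sum_congr rfl fun ρ _ => ?_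
    rw [sum_mul]
    refine sum_congr rfl fun σ _ => ?_
    rw [sum_mul, sum_mul, sum_mul, sum_mul, sum_mul]
    refine sum_congr rfl fun υ _ => ?_
    rw [mul_sum, sum_mul, sum_mul]
    exact sum_congr rfl fun τ _ => by ring
  · simp only [mRule, conv_eq_sum_five, shift_eq]
    refine sum_congr rfl fun o _ => sum_congr rfl fun r _ =>
      sum_congr rfl fun s _ => sum_congr rfl fun t _ => sum_congr rfl fun υ _ =>
      sum_congr rfl fun ρ _ => sum_congr rfl fun σ _ => sum_congr rfl fun τ _ => ?_
    rw [mul_assoc, mul_assoc, mul_sum, mul_sum]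
    congr 1
    exact sum_congr rfl fun m _ => by ring

theorem hasExpansion_type10 (T : MatterTensor .type10) :
    HasExpansion (amplitude a c x) (legOf a) ϰ
      (fun z => matterLagrangian .type10 (metricOf a c z) (fun _ => T) x)
      (fun n b => mRule ϰ n .type10 T b) := by
  refine ((HasExpansion.sum univ fun o _ => HasExpansion.sum univ fun r _ =>
    HasExpansion.sum univ fun s _ => HasExpansion.sum univ fun t _ =>
    HasExpansion.sum univ fun υ _ => HasExpansion.sum univ fun ρ _ =>
    HasExpansion.sum univ fun σ _ => HasExpansion.sum univ fun τ _ =>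
    ((hasExpansion_christoffelLower a c x ϰ ρ σ τ).mul
    ((hasExpansion_raisedVielbein a c x ϰ υ o).mul
      ((hasExpansion_invVielbein a c x ϰ ρ r).mul
        ((hasExpansion_invVielbein a c x ϰ σ s).mul
          ((hasExpansion_invVielbein a c x ϰ τ t).mul (hasExpansion_volume a c x ϰ)
            (hRule_dependsOnFirst ϰ _ τ t))
          (hRule_dependsOnFirst ϰ _ σ s))
        (hRule_dependsOnFirst ϰ _ ρ r))
      (hRule_dependsOnFirst ϰ _ υ o)) (linearRule_dependsOnFirst _)).const_mul
        (T ![o, r, s, t] * eta 0 υ)).congr ?_).congr_rule fun n b => ?_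
  · filter_upwards [eventually_vielbein_eq a c x,
      eventually_vielbein_mul_christoffel a c x] with z hz hz'
    have h : matterLagrangian .type10 (metricOf a c z) (fun _ => T) x =
        ∑ o, (∑ ρ, ∑ r, ∑ σ, ∑ s, ∑ t, vielbein (metricOf a c z x) o 0 *
          invVielbein (metricOf a c z x) ρ r * invVielbein (metricOf a c z x) σ s *
          (∑ τ, vielbein (metricOf a c z x) t τ * christoffel (metricOf a c z) ρ σ τ x) *
          T ![o, r, s, t]) * volDensity (metricOf a c z x) := by
      simp only [matterLagrangian, matterScalar]
      rw [sum_mul]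
      refine sum_congr rfl fun o _ => ?_
      congr 1
      refine sum_congr rfl fun ρ _ => sum_congr rfl fun r _ => sum_congr rfl fun σ _ =>
        sum_congr rfl fun s _ => ?_
      rw [sum_comm]
      refine sum_congr rfl fun t _ => ?_
      rw [mul_sum, sum_mul]
      exact sum_congr rfl fun τ _ => by ring
    rw [h]
    simp only [hz']
    rw [eq_comm]
    refine sum_congr rfl fun o _ => ?_
    rw [sum_reorder_five, hz]
    rw [sum_mul]
    refine sum_congr rfl fun r _ => ?_
    rw [sum_mul]
    refine sum_congr rfl fun s _ => ?_
    rw [sum_mul]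
    refine sum_congr rfl fun t _ => ?_
    rw [sum_mul]
    refine Eq.trans ?_ (sum_comm.trans (sum_congr rfl fun ρ _ => sum_comm)).symm
    refine sum_congr rfl fun ρ _ => ?_
    rw [sum_mul]
    refine sum_congr rfl fun σ _ => ?_
    rw [sum_mul, sum_mul, sum_mul, sum_mul, sum_mul]
    refine sum_congr rfl fun υ _ => ?_
    rw [mul_sum, sum_mul, sum_mul]
    exact sum_congr rfl fun τ _ => by ring
  · simp only [mRule, conv_linearRule, sum_splittings_add _ _ 1]
    simp only [conv_eq_sum_five, shift_shift]
    refine sum_congr rfl fun o _ => sum_congr rfl fun r _ =>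
      sum_congr rfl fun s _ => sum_congr rfl fun t _ => sum_congr rfl fun υ _ =>
      sum_congr rfl fun ρ _ => sum_congr rfl fun σ _ => sum_congr rfl fun τ _ => ?_
    split_ifs
    · rw [mul_assoc (T ![o, r, s, t]), mul_assoc (T ![o, r, s, t])]
      congr 1
      rw [mul_left_comm]
      congr 1
      rw [mul_sum]
      refine sum_congr rfl fun m _ => ?_
      simp only [shift_eq, ← Nat.add_assoc]
      ring
    · simp

end

/-! ### Polarization -/

theorem hasExpansion_matterLagrangian {ι : Type*} [Fintype ι] (a : ι → Leg) (c : ι → ℂ)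
    (x : Spacetime) (ϰ : ℝ) (k : MatterType) (T : MatterTensor k) :
    HasExpansion (amplitude a c x) (legOf a) ϰ
      (fun z => matterLagrangian k (metricOf a c z) (fun _ => T) x)
      (fun n b => mRule ϰ n k T b) := by
  cases k
  · exact hasExpansion_type1 a c x ϰ T
  · exact hasExpansion_type2 a c x ϰ T
  · exact hasExpansion_type3 a c x ϰ T
  · exact hasExpansion_type4 a c x ϰ T
  · exact hasExpansion_type5 a c x ϰ T
  · exact hasExpansion_type6 a c x ϰ T
  · exact hasExpansion_type7 a c x ϰ T
  · exact hasExpansion_type8 a c x ϰ T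
  · exact hasExpansion_type9 a c x ϰ T
  · exact hasExpansion_type10 a c x ϰ T

/-- The part of order `ϰ ^ n`, as a homogeneous polynomial in the amplitudes. -/
theorem orderPart_superposition {ι : Type*} [Fintype ι] (a : ι → Leg) (c : ι → ℂ)
    (x : Spacetime) (ϰ : ℝ) (k : MatterType) (n : ℕ) (T : MatterTensor k) (q : Fin 4 → ℂ) :
    orderPart k n ϰ (fun y => ∑ j, c j • gravitonMode (a j) y) (fun y => mode q y • T) x =
      mode q x * legSum (amplitude a c x) (legOf a) n (mRule ϰ n k T) := by
  obtain ⟨φ, h1, h2⟩ := hasExpansion_matterLagrangian a c x ϰ k T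
  have h3 : (fun z : ℂ => matterLagrangian k
      (fun y => eta + z • ∑ j, c j • gravitonMode (a j) y) (fun y => mode q y • T) x) =
      fun z => mode q x * matterLagrangian k (metricOf a c z) (fun _ => T) x := by
    funext z
    rw [matterLagrangian_smul]
    rfl
  rw [orderPart, h3, ((hasTaylor_const (mode q x)).mul h1).iteratedDeriv_eq,
    PowerSeries.coeff_C_mul, ← h2]
  have : (n.factorial : ℂ) ≠ 0 := by exact_mod_cast n.factorial_ne_zero
  field_simp

/-- The full polarization of a homogeneous polynomial of degree `n` in the amplitudes, presented as
a sum over words: only the words in which every graviton occurs once survive. -/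
theorem iteratedFDeriv_sum_words {n : ℕ} {B : Type*} [Fintype B]
    (M : (Fin n → Fin n) → (Fin n → B) → ℂ) :
    iteratedFDeriv ℂ n (fun c : Fin n → ℂ =>
        ∑ f : Fin n → Fin n × B, (∏ i, c (f i).1) * M (fun i => (f i).1) (fun i => (f i).2)) 0
      (fun j => Pi.single j 1) = ∑ s : Equiv.Perm (Fin n), ∑ b : Fin n → B, M s b := by
  let L : ContinuousMultilinearMap ℂ (fun _ : Fin n => Fin n → ℂ) ℂ :=
    ∑ f : Fin n → Fin n × B, M (fun i => (f i).1) (fun i => (f i).2) •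
      (ContinuousMultilinearMap.mkPiAlgebra ℂ (Fin n) ℂ).compContinuousLinearMap
        fun i => ContinuousLinearMap.proj (f i).1
  have hL : ∀ v : Fin n → Fin n → ℂ, L v = ∑ f : Fin n → Fin n × B,
      (∏ i, v i (f i).1) * M (fun i => (f i).1) (fun i => (f i).2) := fun v => by
    simp only [L, _root_.sum_apply, _root_.smul_apply,
      ContinuousMultilinearMap.compContinuousLinearMap_apply,
      ContinuousMultilinearMap.mkPiAlgebra_apply, ContinuousLinearMap.proj_apply, smul_eq_mul]
    exact sum_congr rfl fun f _ => mul_comm _ _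
  have h1 : (fun c : Fin n → ℂ => ∑ f : Fin n → Fin n × B,
      (∏ i, c (f i).1) * M (fun i => (f i).1) (fun i => (f i).2)) = fun c => L fun _ => c :=
    funext fun c => (hL fun _ => c).symm
  rw [h1, ContinuousMultilinearMap.iteratedFDeriv_comp_diagonal]
  refine sum_congr rfl fun s _ => ?_
  rw [hL, ← (Equiv.arrowProdEquivProdArrow (Fin n) (fun _ => Fin n) (fun _ => B)).symm.sum_comp,
    Fintype.sum_prod_type, sum_eq_single (s : Fin n → Fin n)]
  · refine sum_congr rfl fun b _ => ?_
    simp [Equiv.arrowProdEquivProdArrow]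
  · intro g _ hg
    refine sum_eq_zero fun b _ => ?_
    obtain ⟨i, hi⟩ : ∃ i, g i ≠ s i := by
      by_contra! h
      exact hg (funext h)
    rw [prod_eq_zero (mem_univ i), zero_mul]
    simp [Equiv.arrowProdEquivProdArrow, hi]
  · simp

theorem vertexRule_eq (k : MatterType) (n : ℕ) (ϰ : ℝ) (T : MatterTensor k) (q : Fin 4 → ℂ)
    (a : Fin n → Leg) (x : Spacetime) :
    vertexRule k n ϰ T q a x = Complex.I / 2 ^ n * ∑ b : Fin n → Bool, ∑ s : Equiv.Perm (Fin n),
      mRule ϰ n k T (toSeq fun i => (a (s i)).swapIf (b (s i))) := by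
  have h1 : ∀ c : Fin n → ℂ,
      orderPart k n ϰ (fun y => ∑ j, c j • gravitonMode (a j) y) (fun y => mode q y • T) x =
      ∑ f : Fin n → Fin n × Bool, (∏ i, c (f i).1) *
        (mode q x * ((1 / 2) ^ n * mRule ϰ n k T (toSeq fun i => (a (f i).1).swapIf (f i).2) *
          mode (∑ i, (a (f i).1).p) x)) := fun c => by
    rw [orderPart_superposition, legSum_amplitude, mul_sum]
    refine sum_congr rfl fun f _ => ?_
    rw [prod_mul_distrib, prod_const, card_univ, Fintype.card_fin]
    simp only [legOf_p]
    simp only [legOf]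
    ring
  have h2 := iteratedFDeriv_sum_words fun (f : Fin n → Fin n) (b : Fin n → Bool) =>
    mode q x * ((1 / 2) ^ n * mRule ϰ n k T (toSeq fun i => (a (f i)).swapIf (b i)) *
      mode (∑ i, (a (f i)).p) x)
  rw [vertexRule, distinguishable, funext h1, h2,
    sum_comm (s := (univ : Finset (Fin n → Bool))), mul_sum, mul_sum]
  refine sum_congr rfl fun s _ => ?_
  rw [← (Equiv.arrowCongr s.symm (Equiv.refl Bool)).sum_comp, mul_sum, mul_sum]
  refine sum_congr rfl fun b _ => ?_
  simp only [Equiv.arrowCongr_apply, Equiv.coe_refl, Function.comp_apply, id_eq,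
    Equiv.symm_symm]
  -- the stripped mode of the total momentum cancels the product of the single modes
  rw [Equiv.sum_comp s fun i => (a i).p, mode_add, one_div, inv_pow]
  have hq := mode_ne_zero q x
  have hp := mode_ne_zero (∑ j, (a j).p) x
  field_simp

end GravitonMatter

end

theorem mainTheorem5 (k : GravitonMatter.MatterType) (n : ℕ) (ϰ : ℝ)
    (T : GravitonMatter.MatterTensor k) (q : Fin 4 → ℂ) (a : Fin n → GravitonMatter.Leg)
    (x : GravitonMatter.Spacetime) :
    GravitonMatter.vertexRule k n ϰ T q a x =
      Complex.I / 2 ^ n *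
        ∑ b : Fin n → Bool, ∑ s : Equiv.Perm (Fin n),
          GravitonMatter.mRule ϰ n k T
            (GravitonMatter.toSeq fun i => (a (s i)).swapIf (b (s i))) :=
  GravitonMatter.vertexRule_eq k n ϰ T q a x
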